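/- Let $p$ be a prime number and $V$ an abelian group. Let $I\subset\mathbb{F}_p[V]$ be the augmentation ideal of the group algebra, and let $S^*_{(p)}(V)=\bigoplus_{d\ge 0} I^d/I^{d+1}$ (with $I^0=\mathbb{F}_p[V]$) be the graded algebra associated with the filtration of $\mathbb{F}_p[V]$ by the powers of $I$; the map $v\mapsto [v]-1$ induces an additive map $V\to S^1_{(p)}(V)=I/I^2$. Let $\Lambda^*(V)$ be the exterior algebra of the $\mathbb{Z}$-module $V$. For $n\in\mathbb{N}$, let $K^n_*(V)$ be the complex of $\mathbb{F}_p$-vector spaces (tensor products over $\mathbb{Z}$) $$0\to\mathbb{F}_p\otimes\Lambda^n(V)\to S^1_{(p)}(V)\otimes\Lambda^{n-1}(V)\to\dots\to S^{n-1}_{(p)}(V)\otimes\Lambda^1(V)\to S^n_{(p)}(V)\to 0,$$ with $S^{n-i}_{(p)}(V)\otimes\Lambda^i(V)$ in degree $i$, whose differential $S^{n-i}_{(p)}(V)\otimes\Lambda^i(V)\to S^{n-i+1}_{(p)}(V)\otimes\Lambda^{i-1}(V)$ is the composite of the map induced by the coproduct component $\Lambda^i(V)\to\Lambda^{i-1}(V)\otimes\Lambda^1(V)$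 of the exterior algebra and of the map induced by $\Lambda^1(V)=V\to S^1_{(p)}(V)$ and the product $S^1_{(p)}(V)\otimes S^{n-i}_{(p)}(V)\to S^{n-i+1}_{(p)}(V)$. Explicitly, $$s\otimes(v_1\wedge\dots\wedge v_i)\mapsto\sum_{k=1}^{i}(-1)^{i-k}\,s\cdot([v_k]-1)\otimes(v_1\wedge\dots\widehat{v_k}\dots\wedge v_i).$$ Let $H_*(n)(V)$ denote the homology of $K^n_*(V)$. Let $r\in\mathbb{N}$ and suppose that the $p$-primary torsion of $V$ is bounded by $p^r$, that is, every $v\in V$ killed by some power of $p$ satisfies $p^r v=0$. Then $H_i(n)(V)=0$ for all $i,n\in\mathbb{N}$ with $n>p^r i$. -/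

import Mathlib

open CategoryTheory
open scoped TensorProduct

namespace KoszulGr

noncomputable section

universe u

/-! ### The Koszul construction over an arbitrary base ring -/

section Koszul

variable {R K : Type*} [CommRing R] [CommRing K] [Algebra R K]
  {M : Type*} [AddCommGroup M] [Module R M]

/-- The bilinear map `v ↦ (w ↦ (w_0 ∧ … ∧ w_{i-1}) ⊗ v)`, alternating in `w`. -/
def wedgeTensor (R : Type*) [CommRing R] (M : Type*) [AddCommGroup M] [Module R M] (i : ℕ) :
    M →ₗ[R] M [⋀^Fin i]→ₗ[R] ((⋀[R]^i M) ⊗[R] M) where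
  toFun v := ((TensorProduct.mk R (⋀[R]^i M) M).flip v).compAlternatingMap
    (exteriorPower.ιMulti R i)
  map_add' v w := by ext; simp
  map_smul' c v := by ext; simp

/-- The component `Λ^{i+1}(M) → Λ^i(M) ⊗ M` of the coproduct of the exterior algebra `Λ^*(M)`:
`v_0 ∧ … ∧ v_i ↦ ∑_k (-1)^{i-k} (v_0 ∧ … v̂_k … ∧ v_i) ⊗ v_k`. -/
def coprod (R : Type*) [CommRing R] (M : Type*) [AddCommGroup M] [Module R M] (i : ℕ) :
    (⋀[R]^(i + 1) M) →ₗ[R] (⋀[R]^i M) ⊗[R] M :=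
  exteriorPower.alternatingMapLinearEquiv (R := R) (M := M) (N := (⋀[R]^i M) ⊗[R] M)
    ((-1 : R) ^ i • AlternatingMap.alternatizeUncurryFin (R := R) (M := M)
      (N := (⋀[R]^i M) ⊗[R] M) (wedgeTensor R M i))

lemma coprod_ιMulti (i : ℕ) (v : Fin (i + 1) → M) :
    coprod R M i (exteriorPower.ιMulti R (i + 1) v)
      = (-1 : R) ^ i • ∑ k : Fin (i + 1), (-1 : ℤ) ^ (k : ℕ) •
          (exteriorPower.ιMulti R i (k.removeNth v) ⊗ₜ[R] v k) := by
  simp [coprod, wedgeTensor, AlternatingMap.alternatizeUncurryFin_apply]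

/-- The `K`-module `N ⊗_R Λ^i_R(M)`, for a `K`-module `N` over an `R`-algebra `K`. -/
abbrev KTerm (R : Type*) [CommRing R] (M : Type*) [AddCommGroup M] [Module R M]
    (N : Type*) [AddCommGroup N] [Module R N] (i : ℕ) : Type _ :=
  N ⊗[R] (⋀[R]^i M)

variable {N N' N'' : Type*}
  [AddCommGroup N] [Module R N] [Module K N] [IsScalarTower R K N]
  [AddCommGroup N'] [Module R N'] [Module K N'] [IsScalarTower R K N']
  [AddCommGroup N''] [Module R N''] [Module K N''] [IsScalarTower R K N'']

/-- The Koszul differential attached to a bilinear product `μ : N × M → N'`: the composite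
`N ⊗ Λ^{i+1} → N ⊗ (Λ^i ⊗ M) ≃ (N ⊗ M) ⊗ Λ^i → N' ⊗ Λ^i` of the map induced by the coproduct of
the exterior algebra and of the map induced by the product `μ`. -/
def koszulStep (μ : N →ₗ[K] M →ₗ[R] N') (i : ℕ) :
    KTerm R M N (i + 1) →ₗ[K] KTerm R M N' i :=
  TensorProduct.AlgebraTensorModule.map
      (TensorProduct.AlgebraTensorModule.lift μ) LinearMap.id ∘ₗ
    (TensorProduct.AlgebraTensorModule.assoc R R K N M (⋀[R]^i M)).symm.toLinearMap ∘ₗ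
    TensorProduct.AlgebraTensorModule.map LinearMap.id
      ((TensorProduct.comm R (⋀[R]^i M) M).toLinearMap ∘ₗ coprod R M i)

lemma koszulStep_tmul_ιMulti (μ : N →ₗ[K] M →ₗ[R] N') (i : ℕ) (s : N) (v : Fin (i + 1) → M) :
    koszulStep μ i (s ⊗ₜ[R] exteriorPower.ιMulti R (i + 1) v)
      = (-1 : R) ^ i • ∑ l : Fin (i + 1), (-1 : ℤ) ^ (l : ℕ) •
          (μ s (v l) ⊗ₜ[R] exteriorPower.ιMulti R i (l.removeNth v)) := by
  have key : ∀ t : (⋀[R]^i M) ⊗[R] M, ∀ s : N,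
      TensorProduct.AlgebraTensorModule.map
        (TensorProduct.AlgebraTensorModule.lift μ) LinearMap.id
        ((TensorProduct.AlgebraTensorModule.assoc R R K N M (⋀[R]^i M)).symm
          (s ⊗ₜ[R] (TensorProduct.comm R (⋀[R]^i M) M t)))
      = TensorProduct.lift ((TensorProduct.mk R N' (⋀[R]^i M)).flip.compl₂ (μ s)) t := by
    intro t s
    induction t with
    | zero => simp
    | tmul x y => simp
    | add x y hx hy => simp only [map_add, TensorProduct.tmul_add, hx, hy]
  change TensorProduct.AlgebraTensorModule.map
        (TensorProduct.AlgebraTensorModule.lift μ) LinearMap.id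
        ((TensorProduct.AlgebraTensorModule.assoc R R K N M (⋀[R]^i M)).symm
          (s ⊗ₜ[R] (TensorProduct.comm R (⋀[R]^i M) M (coprod R M i _)))) = _
  rw [key, coprod_ιMulti]
  simp

/-- The square of the Koszul differential is zero when the product is commutative. -/
lemma koszulStep_comp (μ : N →ₗ[K] M →ₗ[R] N') (ν : N' →ₗ[K] M →ₗ[R] N'')
    (hc : ∀ s v w, ν (μ s v) w = ν (μ s w) v) (i : ℕ) :
    koszulStep ν i ∘ₗ koszulStep μ (i + 1) = 0 := by
  refine TensorProduct.AlgebraTensorModule.ext fun s x => ?_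
  rw [LinearMap.zero_apply]
  let F : M →ₗ[R] M →ₗ[R] M [⋀^Fin i]→ₗ[R] (KTerm R M N'' i) :=
    LinearMap.mk₂ R
      (fun v w => (TensorProduct.mk R N'' (⋀[R]^i M) (ν (μ s v) w)).compAlternatingMap
        (exteriorPower.ιMulti R i))
      (fun _ _ _ => by ext; simp)
      (fun c v w => by
        ext
        simp [TensorProduct.smul_tmul'])
      (fun _ _ _ => by ext; simp)
      (fun _ _ _ => by ext; simp [TensorProduct.smul_tmul'])
  have hF := AlternatingMap.alternatizeUncurryFin_alternatizeUncurryFinLM_comp_of_symmetric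
    (f := F) (by intro v w; ext; simp [F, hc s v w])
  let G : (⋀[R]^(i + 1 + 1) M) →ₗ[R] KTerm R M N'' i :=
    ((koszulStep ν i ∘ₗ koszulStep μ (i + 1)).restrictScalars R) ∘ₗ
      TensorProduct.mk R N (⋀[R]^(i + 1 + 1) M) s
  suffices h : G = 0 from DFunLike.congr_fun h x
  ext v
  have h := DFunLike.congr_fun hF v
  simp only [AlternatingMap.alternatizeUncurryFin_apply, LinearMap.comp_apply,
    AlternatingMap.alternatizeUncurryFinLM_apply, AlternatingMap.zero_apply] at h
  simp only [LinearMap.compAlternatingMap_apply, G, LinearMap.comp_apply,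
    LinearMap.restrictScalars_apply, TensorProduct.mk_apply, koszulStep_tmul_ιMulti,
    LinearMap.zero_apply]
  rw [LinearMap.map_smul_of_tower, map_sum]
  simp only [map_zsmul, koszulStep_tmul_ιMulti]
  simp only [smul_comm _ ((-1 : R) ^ i), ← Finset.smul_sum]
  have h' : ∀ x y : M, ∀ w : Fin i → M, F x y w
      = ν (μ s x) y ⊗ₜ[R] exteriorPower.ιMulti R i w := fun _ _ _ => rfl
  simp only [h'] at h
  rw [h, smul_zero, smul_zero]

end Koszul

/-! ### The graded algebra of `𝔽_p[V]` for the powers of the augmentation ideal -/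

/-- The augmentation `𝔽_p[V] → 𝔽_p` of the group algebra, sending every `[v]` to `1`. -/
def augmentation (p : ℕ) (V : Type u) [AddCommGroup V] :
    AddMonoidAlgebra (ZMod p) V →ₐ[ZMod p] ZMod p :=
  AddMonoidAlgebra.lift (ZMod p) (ZMod p) V 1

/-- The augmentation ideal `I` of the group algebra `𝔽_p[V]`. -/
def augIdeal (p : ℕ) (V : Type u) [AddCommGroup V] : Ideal (AddMonoidAlgebra (ZMod p) V) :=
  RingHom.ker (augmentation p V)

/-- The decreasing filtration of `𝔽_p[V]` by the powers of the augmentation ideal, indexed by `ℤ`: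
`F^m = I^m` for `m ≥ 0`, and `F^m = 𝔽_p[V]` for `m ≤ 0`. -/
def filt (p : ℕ) (V : Type u) [AddCommGroup V] (m : ℤ) :
    Submodule (ZMod p) (AddMonoidAlgebra (ZMod p) V) :=
  (augIdeal p V ^ m.toNat).restrictScalars (ZMod p)

/-- The graded piece `S^m_{(p)}(V) = F^m / F^{m+1}`: this is `I^m / I^{m+1}` for `m ≥ 0`, and it
is zero for `m < 0`. -/
abbrev S (p : ℕ) (V : Type u) [AddCommGroup V] (m : ℤ) : Type u :=
  filt p V m ⧸ (filt p V (m + 1)).submoduleOf (filt p V m)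

variable {p : ℕ} {V : Type u} [AddCommGroup V]

lemma mul_mem_filt {a b c : ℤ} (h : a + b = c) {x y : AddMonoidAlgebra (ZMod p) V}
    (hx : x ∈ filt p V a) (hy : y ∈ filt p V b) : x * y ∈ filt p V c := by
  have hxy : x * y ∈ augIdeal p V ^ (a.toNat + b.toNat) := by
    rw [pow_add]
    exact Ideal.mul_mem_mul hx hy
  exact Ideal.pow_le_pow_right (by omega) hxy

/-- Multiplication `F^a × F^b → F^c`, where `a + b = c`. -/
def filtMul {a b c : ℤ} (h : a + b = c) :
    filt p V a →ₗ[ZMod p] filt p V b →ₗ[ZMod p] filt p V c :=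
  LinearMap.mk₂ (ZMod p) (fun x y => ⟨x.1 * y.1, mul_mem_filt h x.2 y.2⟩)
    (fun _ _ _ => Subtype.ext (add_mul _ _ _))
    (fun _ _ _ => Subtype.ext (smul_mul_assoc _ _ _))
    (fun _ _ _ => Subtype.ext (mul_add _ _ _))
    (fun _ _ _ => Subtype.ext (mul_smul_comm _ _ _))

/-- The product `S^a × S^b → S^c`, `a + b = c`, of the associated graded algebra. -/
def mulS {a b c : ℤ} (h : a + b = c) : S p V a →ₗ[ZMod p] S p V b →ₗ[ZMod p] S p V c :=
  Submodule.liftQ _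
    (LinearMap.flip
      (Submodule.liftQ _
        (LinearMap.flip ((filtMul h).compr₂ (Submodule.mkQ _)))
        (by
          intro y hy
          rw [LinearMap.mem_ker]
          ext x
          refine (Submodule.Quotient.mk_eq_zero _).2 ?_
          exact mul_mem_filt (by omega) x.2 hy)))
    (by
      intro x hx
      rw [LinearMap.mem_ker]
      ext y
      refine (Submodule.Quotient.mk_eq_zero _).2 ?_
      exact mul_mem_filt (by omega) hx y.2)

lemma mulS_mk {a b c : ℤ} (h : a + b = c) (x : filt p V a) (y : filt p V b) :
    mulS h (Submodule.Quotient.mk x) (Submodule.Quotient.mk y)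
      = Submodule.Quotient.mk (⟨x.1 * y.1, mul_mem_filt h x.2 y.2⟩ : filt p V c) := rfl

lemma single_sub_one_mem (v : V) :
    (AddMonoidAlgebra.single v 1 - 1 : AddMonoidAlgebra (ZMod p) V) ∈ filt p V 1 := by
  change _ ∈ augIdeal p V ^ 1
  rw [pow_one, augIdeal, RingHom.mem_ker, map_sub, map_one]
  simp [augmentation]

/-- The natural map `V → S^1_{(p)}(V) = I / I^2`, `v ↦ [v] - 1`. -/
def toS1 (p : ℕ) (V : Type u) [AddCommGroup V] : V →ₗ[ℤ] S p V 1 :=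
  AddMonoidHom.toIntLinearMap <| AddMonoidHom.mk'
    (fun v => Submodule.Quotient.mk ⟨AddMonoidAlgebra.single v 1 - 1, single_sub_one_mem v⟩)
    (by
      intro v w
      rw [← Submodule.Quotient.mk_add, Submodule.Quotient.eq]
      have h := mul_mem_filt (show (1 : ℤ) + 1 = 1 + 1 from rfl)
        (single_sub_one_mem (p := p) v) (single_sub_one_mem (p := p) w)
      change (AddMonoidAlgebra.single (v + w) 1 - 1 - ((AddMonoidAlgebra.single v 1 - 1) +
        (AddMonoidAlgebra.single w 1 - 1)) : AddMonoidAlgebra (ZMod p) V) ∈ filt p V (1 + 1)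
      convert h using 1
      have hs : (AddMonoidAlgebra.single (v + w) 1 : AddMonoidAlgebra (ZMod p) V)
          = AddMonoidAlgebra.single v 1 * AddMonoidAlgebra.single w 1 := by
        rw [AddMonoidAlgebra.single_mul_single, one_mul]
      rw [hs]
      ring)

/-- Multiplication `S^j × V → S^k`, `j + 1 = k`, by elements of `V` seen in `S^1`. -/
def mulV {j k : ℤ} (h : j + 1 = k) : S p V j →ₗ[ZMod p] V →ₗ[ℤ] S p V k where
  toFun s := ((mulS h s).restrictScalars ℤ).comp (toS1 p V)
  map_add' s t := by ext v; simp
  map_smul' c s := by ext v; simp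

lemma mulV_comm {a b c : ℤ} (h : a + 1 = b) (h' : b + 1 = c) (s : S p V a) (v w : V) :
    mulV h' (mulV h s v) w = mulV h' (mulV h s w) v := by
  induction s using Submodule.Quotient.induction_on with
  | _ x =>
    refine congrArg Submodule.Quotient.mk (Subtype.ext ?_)
    exact mul_right_comm _ _ _

lemma subsingleton_S {m : ℤ} (hm : m < 0) : Subsingleton (S p V m) := by
  rw [Submodule.Quotient.subsingleton_iff, Submodule.submoduleOf_eq_top]
  have h1 : m.toNat = 0 := by omega
  have h2 : (m + 1).toNat = 0 := by omega
  rw [filt, filt, h1, h2]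

/-- The module `S^{n-i}_{(p)}(V) ⊗_ℤ Λ^i(V)` of degree `i` of the complex `K^n_*(V)`. It is zero
for `i > n`, and `S^0_{(p)}(V) = 𝔽_p[V] / I = 𝔽_p`. -/
abbrev koszulX (p : ℕ) (V : Type u) [AddCommGroup V] (n i : ℕ) : Type u :=
  KTerm ℤ V (S p V ((n : ℤ) - i)) i

/-- The differential `S^{n-i-1}_{(p)}(V) ⊗ Λ^{i+1}(V) → S^{n-i}_{(p)}(V) ⊗ Λ^i(V)`. -/
def koszulD (p : ℕ) (V : Type u) [AddCommGroup V] (n i : ℕ) :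
    koszulX p V n (i + 1) →ₗ[ZMod p] koszulX p V n i :=
  koszulStep (mulV (by push_cast; ring)) i

lemma koszulD_comp (p : ℕ) (V : Type u) [AddCommGroup V] (n i : ℕ) :
    koszulD p V n i ∘ₗ koszulD p V n (i + 1) = 0 :=
  koszulStep_comp _ _ (fun s v w => mulV_comm _ _ s v w) i

/-- The Koszul type complex `K^n_*(V)`
`0 → 𝔽_p ⊗ Λ^n(V) → S^1_{(p)}(V) ⊗ Λ^{n-1}(V) → ⋯ → S^n_{(p)}(V) → 0`,
graded so that `S^{n-i}_{(p)}(V) ⊗ Λ^i(V)` is in degree `i`. -/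
def koszulComplex (p : ℕ) (V : Type u) [AddCommGroup V] (n : ℕ) :
    ChainComplex (ModuleCat.{u} (ZMod p)) ℕ :=
  ChainComplex.of (fun i => ModuleCat.of (ZMod p) (koszulX p V n i))
    (fun i => ModuleCat.ofHom (koszulD p V n i))
    (fun i => by rw [← ModuleCat.ofHom_comp, koszulD_comp]; rfl)

end

end KoszulGr

/-! Choose elements `v b` of `V` whose classes form a basis of `V / p`, adapted to the images of the
torsion subgroups `V[p^j]` for `j ≤ r`. Each `v b` either has order `q b = p^k ≤ p^r` or is assigned
a formal order `q b > n`. Modulo a large power of `p`, `V` is the direct sum of the cyclic groups of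
order `q b` generated by the `v b` (`exists_adaptedFamily`). Consequently, in degrees at most `n`,
the graded algebra is the truncated polynomial algebra `𝔽_p[X_b] / (X_b ^ q b)` with `X_b = [v b] -
1` (`linearIndependent_cls`, `top_le_span_cls`).

The Koszul complex then looks like a tensor product over `b` of the complexes `𝔽_p[X] / (X^q) ⊗
Λ(e)` with `d e = X`, whose homology is spanned by `1` and by `X^(q-1) e`, of degree `1` and weight
`q`. A class of degree `i` and weight `n` therefore requires `n` to be a sum of `i` of the orders `q
b`. None of these can exceed `n`, so all are at most `p^r` and `n ≤ p^r i`.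

In place of a Künneth argument, each `b` gives a homotopy `h`: divide by `X_b` and wedge with `v b`.
The operator `d h + h d` is diagonal on monomial tensors, with eigenvalue `1` or `0`. When `n > p^r
i`, every tensor has eigenvalue `1` for some `b` (`exists_moves`), and `le_range_of_diagonal` turns
this into exactness. -/

namespace KoszulGr

universe u

/-! ### Adapted families in an abelian group. -/

/-- A flag of subsets of a vector space has an adapted linearly independent family. -/
lemma exists_flag_adapted {K W : Type*} [Field K] [AddCommGroup W] [Module K W]
    (t : ℕ → Set W) (ht : Monotone t) :
    ∃ s : ℕ → Set W, Monotone s ∧ (∀ j, s j ⊆ t j) ∧ (∀ j, LinearIndepOn K id (s j)) ∧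
      ∀ j, t j ⊆ Submodule.span K (s j) := by
  have step : ∀ (j : ℕ) (a : {a : Set W // a ⊆ t j ∧ LinearIndepOn K id a}),
      ∃ b : Set W, b ⊆ t j ∧ a.1 ⊆ b ∧ t j ⊆ Submodule.span K b ∧ LinearIndepOn K id b := by
    intro j a
    obtain ⟨b, h1, h2, h3, h4⟩ := exists_linearIndepOn_extension a.2.2 a.2.1
    exact ⟨b, h1, h2, by simpa using h3, h4⟩
  choose e he1 he2 he3 he4 using step
  let s : (j : ℕ) → {a : Set W // a ⊆ t j ∧ LinearIndepOn K id a} := fun j =>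
    Nat.rec ⟨e 0 ⟨∅, by simp, linearIndepOn_empty K id⟩, he1 _ _, he4 _ _⟩
      (fun j a => ⟨e (j + 1) ⟨a.1, a.2.1.trans (ht j.le_succ), a.2.2⟩, he1 _ _, he4 _ _⟩) j
  refine ⟨fun j => (s j).1, monotone_nat_of_le_succ fun j => ?_, fun j => (s j).2.1,
    fun j => (s j).2.2, fun j => ?_⟩
  · exact he2 (j + 1) ⟨(s j).1, (s j).2.1.trans (ht j.le_succ), (s j).2.2⟩
  · cases j with
    | zero => exact he3 _ _
    | succ j => exact he3 _ _

/-- Elements `v b` of `V` spanning `V / p`, whose classes modulo a large power of `p` form a basis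
of cyclic summands, `v b` generating a summand of order `q b`; the `q b` are either at most `t`,
and then exact orders, or larger than `n`. -/
structure AdaptedFamily (p : ℕ) (V : Type*) [AddCommGroup V] (t n : ℕ) (B : Type*)
    [DecidableEq B] where
  /-- the elements -/
  v : B → V
  /-- the orders of the summands -/
  q : B → ℕ
  /-- the coordinates -/
  coord : V →+ DirectSum B fun b => ZMod (q b)
  exists_pow : ∀ b, ∃ k, q b = p ^ k
  q_spec : ∀ b, (q b ≤ t ∧ q b • v b = 0) ∨ n < q b
  closure_eq : AddSubgroup.closure (Set.range v ∪ Set.range fun u : V => p • u) = ⊤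
  coord_v : ∀ b, coord (v b) = DirectSum.of (fun b => ZMod (q b)) b 1

/-! ### Decomposition of `V` modulo a power of `p` into cyclic groups. -/

section PAdic

variable {p : ℕ} {V : Type*} [AddCommGroup V]

lemma mkQ_nsmul (u : V) : ModN.mkQ p (p • u) = 0 :=
  (Submodule.Quotient.mk_eq_zero _).2 ⟨u, by simp⟩

lemma exists_of_mkQ_eq_zero {u : V} (h : ModN.mkQ p u = 0) : ∃ w : V, u = p • w := by
  obtain ⟨w, hw⟩ := (Submodule.Quotient.mk_eq_zero _).1 h
  exact ⟨w, by rw [← hw]; simp⟩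

/-- The divisibility statement behind the independence of an adapted family modulo `p ^ N`. -/
lemma pow_dvd_of_sum_eq [Fact p.Prime] {B : Type*} {v : B → V} {k : B → ℕ} {N : ℕ}
    (hli : LinearIndependent (ZMod p) fun b => ModN.mkQ p (v b)) (hkN : ∀ b, k b ≤ N)
    (hkv : ∀ b, k b < N → p ^ k b • v b = 0)
    (hspan : ∀ (w : V) (j : ℕ), j < N → p ^ j • w = 0 →
      ModN.mkQ p w ∈ Submodule.span (ZMod p) ((fun b => ModN.mkQ p (v b)) '' {b | k b ≤ j}))
    (F : Finset B) (c : B → ℤ) (u : V) (hu : ∑ b ∈ F, c b • v b = p ^ N • u) :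
    ∀ b ∈ F, (p : ℤ) ^ k b ∣ c b := by
  classical
  -- The divisibility is gained one power of `p` at a time; a coefficient stops improving once it
  -- reaches `p ^ k b`, where its term vanishes if `k b < N`.
  suffices h : ∀ j ≤ N, ∀ b ∈ F, (p : ℤ) ^ min j (k b) ∣ c b by
    intro b hb
    simpa [hkN b] using h N le_rfl b hb
  intro j
  induction j with
  | zero => simp
  | succ j ih =>
    intro hj
    replace ih := ih (by omega)
    have hc : ∀ b, ∃ c' : ℤ, b ∈ F → j < k b → c b = p ^ j * c' := by
      intro b
      by_cases hb : b ∈ F ∧ j < k b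
      · obtain ⟨c', hc'⟩ := ih b hb.1
        rw [min_eq_left hb.2.le] at hc'
        exact ⟨c', fun _ _ => hc'⟩
      · exact ⟨0, fun h1 h2 => absurd ⟨h1, h2⟩ hb⟩
    choose c' hc' using hc
    have hsum : ∑ b ∈ F, c b • v b = p ^ j • ∑ b ∈ F with j < k b, c' b • v b := by
      rw [Finset.sum_filter, Finset.smul_sum]
      refine Finset.sum_congr rfl fun b hb => ?_
      split_ifs with h
      · rw [hc' b hb h, mul_smul, ← Nat.cast_pow, natCast_zsmul]
      · obtain ⟨m, hm⟩ := ih b hb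
        rw [min_eq_right (by omega)] at hm
        rw [smul_zero, hm, mul_comm, mul_smul, ← Nat.cast_pow, natCast_zsmul,
          hkv b (by omega), smul_zero]
    have hy : p ^ j • ((∑ b ∈ F with j < k b, c' b • v b) - p ^ (N - j) • u) = 0 := by
      rw [smul_sub, ← hsum, hu, smul_smul, ← pow_add, Nat.add_sub_cancel' (by omega), sub_self]
    -- The class of an element killed by `p ^ j` involves only indices with `k b ≤ j`, while this
    -- sum involves only those with `j < k b`. Independence modulo `p` makes every `c' b` divisible
    -- by `p`.
    have hmem := hspan _ j (by omega) hy
    have hz : ModN.mkQ p (p ^ (N - j) • u) = 0 := by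
      obtain ⟨m, hm⟩ : ∃ m, N - j = m + 1 := ⟨N - j - 1, by omega⟩
      rw [hm, pow_succ', mul_smul, mkQ_nsmul]
    have hms : ModN.mkQ p (∑ b ∈ F with j < k b, c' b • v b)
        = Finsupp.linearCombination (ZMod p) (fun b => ModN.mkQ p (v b))
          (Finsupp.onFinset F (fun b => if b ∈ F ∧ j < k b then (c' b : ZMod p) else 0)
            (fun b hb => by by_contra h; simp [h] at hb)) := by
      rw [Finsupp.linearCombination_apply, Finsupp.onFinset_sum _ (by simp), map_sum,
        Finset.sum_filter]
      refine Finset.sum_congr rfl fun b hb => ?_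
      by_cases h : j < k b
      · simp only [h, hb, and_self, if_true, map_zsmul]
        rw [Int.cast_smul_eq_zsmul]
      · simp [h]
    rw [map_sub, hz, sub_zero, hms, Finsupp.mem_span_image_iff_linearCombination] at hmem
    obtain ⟨l, hl, hle⟩ := hmem
    have hl' := hli hle
    intro b hb
    by_cases h : j < k b
    · have h0 : l b = 0 := by
        by_contra h0
        have := hl (Finsupp.mem_support_iff.2 h0)
        simp only [Set.mem_ofPred_eq] at this
        omega
      rw [hl'] at h0
      simp only [Finsupp.onFinset_apply, hb, h, and_self, if_true] at h0
      rw [ZMod.intCast_zmod_eq_zero_iff_dvd] at h0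
      obtain ⟨m, hm⟩ := h0
      rw [min_eq_left (by omega), hc' b hb h, hm, pow_succ, ← mul_assoc]
      exact dvd_mul_right _ _
    · have := ih b hb
      rwa [min_eq_right (by omega)] at this ⊢

/-- Elements spanning `V` modulo `p` span it modulo every power of `p`. -/
lemma exists_add_pow_smul {A : AddSubgroup V} (hA : ∀ x : V, ∃ a ∈ A, ∃ u : V, x = a + p • u)
    (N : ℕ) (x : V) : ∃ a ∈ A, ∃ u : V, x = a + p ^ N • u := by
  induction N with
  | zero => exact ⟨0, A.zero_mem, x, by simp⟩
  | succ N ih =>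
    obtain ⟨a, ha, u, rfl⟩ := ih
    obtain ⟨a', ha', u', rfl⟩ := hA u
    refine ⟨a + p ^ N • a', A.add_mem ha (A.nsmul_mem ha' _), u', ?_⟩
    rw [smul_add, smul_smul, pow_succ, add_assoc]

/-- The coordinates attached to a family of elements that is independent modulo `p ^ N`. -/
lemma exists_coord {B : Type*} [DecidableEq B] {v : B → V} {k : B → ℕ} {N : ℕ}
    (hkN : ∀ b, k b ≤ N) (hkv : ∀ b, k b < N → p ^ k b • v b = 0)
    (hdvd : ∀ (F : Finset B) (c : B → ℤ) (u : V), ∑ b ∈ F, c b • v b = p ^ N • u →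
      ∀ b ∈ F, (p : ℤ) ^ k b ∣ c b)
    (hcl : AddSubgroup.closure (Set.range v ∪ Set.range fun u : V => p • u) = ⊤) :
    ∃ φ : V →+ DirectSum B fun b => ZMod (p ^ k b),
      ∀ b, φ (v b) = DirectSum.of (fun b => ZMod (p ^ k b)) b 1 := by
  let P : AddSubgroup V := (nsmulAddMonoidHom (p ^ N) : V →+ V).range
  let π : V →+ V ⧸ P := QuotientAddGroup.mk' P
  have hP : ∀ x, π x = 0 ↔ ∃ u, x = p ^ N • u := by
    intro x
    rw [QuotientAddGroup.mk'_apply, QuotientAddGroup.eq_zero_iff]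
    constructor
    · rintro ⟨u, rfl⟩
      exact ⟨u, rfl⟩
    · rintro ⟨u, rfl⟩
      exact ⟨u, rfl⟩
  have hlift : ∀ b, (zmultiplesHom _ (π (v b))) ((p ^ k b : ℕ) : ℤ) = 0 := by
    intro b
    rw [zmultiplesHom_apply, natCast_zsmul, ← map_nsmul, hP]
    rcases (hkN b).lt_or_eq with h | h
    · exact ⟨0, by rw [hkv b h, smul_zero]⟩
    · exact ⟨v b, by rw [h]⟩
  let ψ : (DirectSum B fun b => ZMod (p ^ k b)) →+ V ⧸ P :=
    DirectSum.toAddMonoid fun b => ZMod.lift (p ^ k b) ⟨zmultiplesHom _ (π (v b)), hlift b⟩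
  have hψ : ∀ b (m : ℤ), ψ (DirectSum.of (fun b => ZMod (p ^ k b)) b m) = m • π (v b) := by
    intro b m
    simp [ψ]
  have hinj : Function.Injective ψ := by
    rw [injective_iff_map_eq_zero]
    intro x hx
    choose c hc using fun b => ZMod.intCast_surjective (x b)
    have hx' : x = ∑ b ∈ x.support, DirectSum.of (fun b => ZMod (p ^ k b)) b (c b) := by
      conv_lhs => rw [← DirectSum.sum_support_of x]
      simp [hc]
    rw [hx', map_sum] at hx
    simp only [hψ, ← map_zsmul] at hx
    rw [← map_sum, hP] at hx
    obtain ⟨u, hu⟩ := hx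
    have := hdvd _ _ _ hu
    rw [hx']
    refine Finset.sum_eq_zero fun b hb => ?_
    rw [(ZMod.intCast_zmod_eq_zero_iff_dvd (c b) (p ^ k b)).2 (by simpa using this b hb), map_zero]
  -- The image contains generators modulo `p`, hence modulo `p ^ N`, and the remaining error lies in
  -- `P`.
  have hsurj : Function.Surjective ψ := by
    have hA : ∀ x : V, ∃ a ∈ ψ.range.comap π, ∃ u : V, x = a + p • u := by
      intro x
      have hx : x ∈ AddSubgroup.closure (Set.range v ∪ Set.range fun u : V => p • u) := by
        rw [hcl]; trivial
      induction hx using AddSubgroup.closure_induction with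
      | mem x hx =>
        rcases hx with ⟨b, rfl⟩ | ⟨u, rfl⟩
        · refine ⟨v b, ⟨DirectSum.of (fun b => ZMod (p ^ k b)) b ((1 : ℤ) : ZMod _), ?_⟩, 0, by simp⟩
          rw [hψ, one_smul]
        · exact ⟨0, AddSubgroup.zero_mem _, u, by simp⟩
      | zero => exact ⟨0, AddSubgroup.zero_mem _, 0, by simp⟩
      | add x y _ _ hx hy =>
        obtain ⟨a, ha, u, rfl⟩ := hx
        obtain ⟨a', ha', u', rfl⟩ := hy
        exact ⟨a + a', AddSubgroup.add_mem _ ha ha', u + u', by rw [smul_add]; abel⟩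
      | neg x _ hx =>
        obtain ⟨a, ha, u, rfl⟩ := hx
        exact ⟨-a, AddSubgroup.neg_mem _ ha, -u, by rw [smul_neg]; abel⟩
    intro y
    obtain ⟨x, rfl⟩ := QuotientAddGroup.mk'_surjective P y
    obtain ⟨a, ⟨z, hz⟩, u, rfl⟩ := exists_add_pow_smul hA N x
    refine ⟨z, ?_⟩
    change ψ z = π _
    rw [hz, map_add, (hP _).2 ⟨u, rfl⟩, add_zero]
  let e := AddEquiv.ofBijective ψ ⟨hinj, hsurj⟩
  refine ⟨e.symm.toAddMonoidHom.comp π, fun b => ?_⟩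
  change e.symm (π (v b)) = _
  rw [AddEquiv.symm_apply_eq]
  have := hψ b 1
  rw [one_smul, Int.cast_one] at this
  exact this.symm

/-- The index set is a basis of `V / p` extending bases of the spans of the images of `V[p^j]`. A
basis vector first appearing at level `j ≤ r` is lifted to an element killed by `p ^ j`; the others
are lifted arbitrarily and receive a formal exponent. -/
theorem exists_adaptedFamily [Fact p.Prime] {r : ℕ}
    (hV : ∀ (v : V) (k : ℕ), p ^ k • v = 0 → p ^ r • v = 0) (n : ℕ) :
    ∃ B : Set (ModN V p), ∀ [DecidableEq B], Nonempty (AdaptedFamily p V (p ^ r) n B) := by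
  classical
  have hp := (Fact.out : p.Prime)
  -- The flag becomes everything from level `r + 1` on, so that `s (r + 1)` is a basis of `V / p`.
  let t : ℕ → Set (ModN V p) := fun j =>
    if j ≤ r then ModN.mkQ p '' {w : V | p ^ j • w = 0} else Set.univ
  have ht : Monotone t := by
    intro i j hij
    simp only [t]
    split_ifs with h1 h2
    · rintro _ ⟨w, hw, rfl⟩
      refine ⟨w, ?_, rfl⟩
      obtain ⟨m, rfl⟩ := Nat.exists_eq_add_of_le hij
      simp only [Set.mem_ofPred_eq] at hw ⊢
      rw [pow_add, mul_comm, mul_smul, hw, smul_zero]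
    · exact Set.subset_univ _
    · omega
    · exact Set.subset_univ _
  obtain ⟨s, hs, hst, hli, hsp⟩ := exists_flag_adapted (K := ZMod p) t ht
  refine ⟨s (r + 1), ?_⟩
  intro _
  -- `N > r` separates the formal exponent from the torsion exponents, and `N > n` gives `p ^ N >
  -- n`.
  set N := n + r + 1 with hN
  have hlift : ∀ b : s (r + 1), ∃ (w : V) (k : ℕ), ModN.mkQ p w = b ∧
      ((k ≤ r ∧ p ^ k • w = 0) ∨ k = N) ∧ ∀ j, b.1 ∈ s j → j ≤ r → k ≤ j := by
    intro b
    by_cases h : ∃ j, b.1 ∈ s j ∧ j ≤ r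
    · have h1 := Nat.find_spec h
      have h2 := hst _ h1.1
      simp only [t, h1.2, if_true] at h2
      obtain ⟨w, hw, hwb⟩ := h2
      exact ⟨w, Nat.find h, hwb, Or.inl ⟨h1.2, hw⟩, fun j hj hjr => Nat.find_min' h ⟨hj, hjr⟩⟩
    · obtain ⟨w, hw⟩ := Submodule.mkQ_surjective _ b.1
      exact ⟨w, N, hw, Or.inr rfl, fun j hj hjr => absurd ⟨j, hj, hjr⟩ h⟩
  choose v k hvb hk hkj using hlift
  have hfun : (fun b => ModN.mkQ p (v b)) = ((↑) : s (r + 1) → ModN V p) := funext hvb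
  have hli' : LinearIndependent (ZMod p) fun b => ModN.mkQ p (v b) := by
    rw [hfun]; exact hli (r + 1)
  have hkN : ∀ b, k b ≤ N := fun b => by rcases hk b with h | h <;> omega
  have hkv : ∀ b, k b < N → p ^ k b • v b = 0 := fun b h => by
    rcases hk b with h' | h'
    · exact h'.2
    · omega
  have hspan : ∀ (w : V) (j : ℕ), j < N → p ^ j • w = 0 →
      ModN.mkQ p w ∈ Submodule.span (ZMod p) ((fun b => ModN.mkQ p (v b)) '' {b | k b ≤ j}) := by
    intro w j _ hw
    -- The bound on the torsion enters here: `j` may be replaced by its minimum with `r`, which is a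
    -- level of the flag coming from torsion.
    obtain ⟨j', hj'r, hj'j, hw'⟩ : ∃ j' ≤ r, j' ≤ j ∧ p ^ j' • w = 0 := by
      rcases le_total j r with h | h
      · exact ⟨j, h, le_rfl, hw⟩
      · exact ⟨r, le_rfl, h, hV w j hw⟩
    have hm : ModN.mkQ p w ∈ t j' := by
      simp only [t, hj'r, if_true]
      exact ⟨w, hw', rfl⟩
    refine Submodule.span_mono ?_ (hsp j' hm)
    intro x hx
    refine ⟨⟨x, hs (by omega) hx⟩, ?_, hvb _⟩
    exact (hkj ⟨x, _⟩ j' hx hj'r).trans hj'j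
  have hcl : AddSubgroup.closure (Set.range v ∪ Set.range fun u : V => p • u) = ⊤ := by
    rw [eq_top_iff]
    intro x _
    set C := AddSubgroup.closure (Set.range v ∪ Set.range fun u : V => p • u) with hC
    have hx : ModN.mkQ p x ∈ Submodule.span (ZMod p) (s (r + 1)) :=
      hsp (r + 1) (by simp [t])
    have hker : ∀ y : V, ModN.mkQ p y ∈ C.map (ModN.mkQ p) → y ∈ C := by
      rintro y ⟨c, hc, hcy⟩
      obtain ⟨u, hu⟩ := exists_of_mkQ_eq_zero (p := p) (u := y - c) (by
        rw [map_sub, hcy, sub_self])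
      rw [sub_eq_iff_eq_add.1 hu]
      exact C.add_mem (AddSubgroup.subset_closure (Or.inr ⟨u, rfl⟩)) hc
    refine hker x ?_
    have hle : Submodule.span (ZMod p) (s (r + 1)) ≤
        AddSubgroup.toZModSubmodule p (C.map (ModN.mkQ p)) := by
      rw [Submodule.span_le]
      intro y hy
      exact ⟨v ⟨y, hy⟩, AddSubgroup.subset_closure (Or.inl ⟨_, rfl⟩), hvb _⟩
    exact hle hx
  obtain ⟨φ, hφ⟩ := exists_coord hkN hkv (fun F c u =>
    pow_dvd_of_sum_eq hli' hkN hkv hspan F c u) hcl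
  refine ⟨⟨v, fun b => p ^ k b, φ, fun b => ⟨_, rfl⟩, fun b => ?_, hcl, hφ⟩⟩
  rcases hk b with h | h
  · exact Or.inl ⟨Nat.pow_le_pow_right hp.pos h.1, h.2⟩
  · refine Or.inr ?_
    rw [h]
    exact (show n < N by omega).trans (Nat.lt_pow_self hp.one_lt)

end PAdic

/-! ### Monomials in the group algebra and comparison with a truncated polynomial algebra. -/

section Monomials

variable {p : ℕ} {V : Type*} [AddCommGroup V]

lemma single_sub_one_mem_augIdeal (v : V) :
    (AddMonoidAlgebra.single v 1 - 1 : AddMonoidAlgebra (ZMod p) V) ∈ augIdeal p V := by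
  simpa [filt] using single_sub_one_mem (p := p) v

/-- The augmentation ideal is spanned by the elements `[v] - 1`. -/
lemma augIdeal_le_span : (augIdeal p V).restrictScalars (ZMod p) ≤ Submodule.span (ZMod p)
    (Set.range fun v : V => (AddMonoidAlgebra.single v 1 - 1 : AddMonoidAlgebra (ZMod p) V)) := by
  have key : ∀ f : AddMonoidAlgebra (ZMod p) V,
      f - algebraMap (ZMod p) _ (augmentation p V f) ∈ Submodule.span (ZMod p)
        (Set.range fun v : V =>
          (AddMonoidAlgebra.single v 1 - 1 : AddMonoidAlgebra (ZMod p) V)) := by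
    intro f
    induction f using AddMonoidAlgebra.induction_on with
    | of v =>
      refine Submodule.subset_span ⟨Multiplicative.toAdd v, ?_⟩
      simp [augmentation, AddMonoidAlgebra.one_def]
      rfl
    | add f g hf hg =>
      rw [map_add, map_add, add_sub_add_comm]
      exact Submodule.add_mem _ hf hg
    | smul c f hf =>
      rw [map_smul, Algebra.algebraMap_eq_smul_one, smul_assoc, ← smul_sub,
        ← Algebra.algebraMap_eq_smul_one]
      exact Submodule.smul_mem _ _ hf
  intro f hf
  have h := key f
  rw [show augmentation p V f = 0 from hf, map_zero, sub_zero] at h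
  exact h

lemma single_sub_one_pow [Fact p.Prime] (v : V) (k : ℕ) :
    (AddMonoidAlgebra.single v 1 - 1 : AddMonoidAlgebra (ZMod p) V) ^ p ^ k
      = AddMonoidAlgebra.single (p ^ k • v) 1 - 1 := by
  have : CharP (AddMonoidAlgebra (ZMod p) V) p :=
    charP_of_injective_algebraMap (algebraMap (ZMod p) _).injective p
  rw [sub_pow_char_pow, one_pow, AddMonoidAlgebra.single_pow, one_pow]

namespace AdaptedFamily

variable {t n : ℕ} {B : Type*} [DecidableEq B] (F : AdaptedFamily p V t n B)

/-- The monomial `∏ b, ([v b] - 1) ^ a b` in `𝔽_p[V]`. -/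
noncomputable def mono (a : B →₀ ℕ) : AddMonoidAlgebra (ZMod p) V :=
  a.prod fun b k => (AddMonoidAlgebra.single (F.v b) 1 - 1) ^ k

lemma mono_zero : F.mono 0 = 1 := Finsupp.prod_zero_index

lemma mono_add (a a' : B →₀ ℕ) : F.mono (a + a') = F.mono a * F.mono a' :=
  Finsupp.prod_add_index' (fun _ => pow_zero _) fun _ _ _ => pow_add _ _ _

lemma mono_single (b : B) (k : ℕ) :
    F.mono (Finsupp.single b k) = (AddMonoidAlgebra.single (F.v b) 1 - 1) ^ k :=
  Finsupp.prod_single_index (pow_zero _)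

lemma mono_mem (a : B →₀ ℕ) : F.mono a ∈ augIdeal p V ^ a.degree := by
  induction a using Finsupp.induction_linear with
  | zero => simp
  | add f g hf hg =>
    rw [mono_add, map_add, pow_add]
    exact Ideal.mul_mem_mul hf hg
  | single b k =>
    rw [mono_single, Finsupp.degree_single]
    exact Ideal.pow_mem_pow (single_sub_one_mem_augIdeal _) _

/-- Monomials with an exponent that is too large vanish. -/
lemma mono_eq_zero [Fact p.Prime] {a : B →₀ ℕ} (ha : a.degree ≤ n) {b : B} (hb : F.q b ≤ a b) :
    F.mono a = 0 := by
  have hle : Finsupp.single b (F.q b) ≤ a := by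
    rwa [Finsupp.single_le_iff]
  obtain ⟨a', rfl⟩ := exists_add_of_le hle
  have h := Finsupp.le_degree b (Finsupp.single b (F.q b) + a')
  rcases F.q_spec b with h' | h'
  · obtain ⟨k, hk⟩ := F.exists_pow b
    rw [mono_add, mono_single, hk, single_sub_one_pow, ← hk, h'.2,
      ← AddMonoidAlgebra.one_def, sub_self, zero_mul]
  · omega

/-- Modulo `I ^ 2`, the ideal `I` is spanned by the monomials of degree `1`. -/
lemma augIdeal_le [Fact p.Prime] : (augIdeal p V).restrictScalars (ZMod p) ≤
    Submodule.span (ZMod p) (F.mono '' {a | a.degree = 1}) ⊔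
      (augIdeal p V ^ 2).restrictScalars (ZMod p) := by
  refine augIdeal_le_span.trans (Submodule.span_le.2 ?_)
  rintro _ ⟨v, rfl⟩
  have hv : v ∈ AddSubgroup.closure (Set.range F.v ∪ Set.range fun u : V => p • u) := by
    rw [F.closure_eq]; trivial
  have hmul : ∀ v w : V, (AddMonoidAlgebra.single v 1 - 1) * (AddMonoidAlgebra.single w 1 - 1) ∈
      Submodule.span (ZMod p) (F.mono '' {a | a.degree = 1}) ⊔
      (augIdeal p V ^ 2).restrictScalars (ZMod p) := by
    intro v w
    refine Submodule.mem_sup_right ?_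
    rw [Submodule.restrictScalars_mem, pow_two]
    exact Ideal.mul_mem_mul (single_sub_one_mem_augIdeal v) (single_sub_one_mem_augIdeal w)
  have hadd : ∀ v w : V, (AddMonoidAlgebra.single (v + w) 1 - 1 : AddMonoidAlgebra (ZMod p) V)
      = (AddMonoidAlgebra.single v 1 - 1) + (AddMonoidAlgebra.single w 1 - 1) +
        (AddMonoidAlgebra.single v 1 - 1) * (AddMonoidAlgebra.single w 1 - 1) := by
    intro v w
    have hs : (AddMonoidAlgebra.single (v + w) 1 : AddMonoidAlgebra (ZMod p) V)
        = AddMonoidAlgebra.single v 1 * AddMonoidAlgebra.single w 1 := by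
      rw [AddMonoidAlgebra.single_mul_single, one_mul]
    rw [hs]
    ring
  simp only [SetLike.mem_coe]
  induction hv using AddSubgroup.closure_induction with
  | mem x hx =>
    rcases hx with ⟨b, rfl⟩ | ⟨u, rfl⟩
    · refine Submodule.mem_sup_left (Submodule.subset_span ⟨Finsupp.single b 1, ?_, ?_⟩)
      · simp
      · rw [mono_single, pow_one]
    -- By Frobenius `[p u] - 1 = ([u] - 1) ^ p`, which lies in `I ^ p ⊆ I ^ 2`.
    · refine Submodule.mem_sup_right ?_
      have h := single_sub_one_pow (p := p) u 1
      rw [pow_one] at h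
      simp only
      rw [← h]
      exact Ideal.pow_le_pow_right (Fact.out : p.Prime).two_le
        (Ideal.pow_mem_pow (single_sub_one_mem_augIdeal u) p)
  | zero => rw [← AddMonoidAlgebra.one_def, sub_self]; exact Submodule.zero_mem _
  | add x y _ _ hx hy =>
    rw [hadd]
    exact Submodule.add_mem _ (Submodule.add_mem _ hx hy) (hmul x y)
  | neg x _ hx =>
    have h := hadd x (-x)
    rw [add_neg_cancel, ← AddMonoidAlgebra.one_def, sub_self] at h
    have h' : (AddMonoidAlgebra.single (-x) 1 - 1 : AddMonoidAlgebra (ZMod p) V)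
        = -((AddMonoidAlgebra.single x 1 - 1) +
          (AddMonoidAlgebra.single x 1 - 1) * (AddMonoidAlgebra.single (-x) 1 - 1)) := by
      rw [eq_neg_iff_add_eq_zero, h]
      ring
    rw [h']
    exact Submodule.neg_mem _ (Submodule.add_mem _ hx (hmul x (-x)))

/-- Modulo `I ^ (m + 1)`, the ideal `I ^ m` is spanned by the monomials of degree `m`. -/
lemma augIdeal_pow_le [Fact p.Prime] (m : ℕ) :
    (augIdeal p V ^ m).restrictScalars (ZMod p) ≤
      Submodule.span (ZMod p) (F.mono '' {a | a.degree = m}) ⊔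
        (augIdeal p V ^ (m + 1)).restrictScalars (ZMod p) := by
  induction m with
  | zero =>
    intro f _
    rw [← add_sub_cancel (augmentation p V f • 1) f]
    refine Submodule.add_mem_sup (Submodule.smul_mem _ _ (Submodule.subset_span ?_)) ?_
    · exact ⟨0, by simp, F.mono_zero⟩
    · rw [Submodule.restrictScalars_mem, zero_add, pow_one, augIdeal, RingHom.mem_ker, map_sub,
        map_smul, map_one]
      simp
  | succ m ih =>
    intro f hf
    rw [Submodule.restrictScalars_mem, pow_succ] at hf
    refine Submodule.mul_induction_on hf ?_ fun x y hx hy => Submodule.add_mem _ hx hy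
    intro x hx y hy
    obtain ⟨x1, hx1, x2, hx2, rfl⟩ := Submodule.mem_sup.1 (ih hx)
    obtain ⟨y1, hy1, y2, hy2, rfl⟩ := Submodule.mem_sup.1 (F.augIdeal_le hy)
    have hx12 : x1 * y2 ∈ augIdeal p V ^ (m + 2) := by
      rw [pow_add]
      refine Ideal.mul_mem_mul ?_ hy2
      have := Ideal.sub_mem _ hx (Ideal.pow_le_pow_right m.le_succ hx2)
      rwa [add_sub_cancel_right] at this
    have hx2y : x2 * (y1 + y2) ∈ augIdeal p V ^ (m + 2) := by
      rw [show m + 2 = m + 1 + 1 from rfl, pow_succ]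
      exact Ideal.mul_mem_mul hx2 hy
    rw [show (x1 + x2) * (y1 + y2) = x1 * y1 + (x1 * y2 + x2 * (y1 + y2)) by ring]
    refine Submodule.add_mem_sup ?_ (Ideal.add_mem _ hx12 hx2y)
    have h := Submodule.mul_mem_mul hx1 hy1
    rw [Submodule.span_mul_span] at h
    refine Submodule.span_mono ?_ h
    rintro _ ⟨_, ⟨a, ha, rfl⟩, _, ⟨a', ha', rfl⟩, rfl⟩
    refine ⟨a + a', ?_, F.mono_add a a'⟩
    simp only [Set.mem_ofPred_eq] at ha ha' ⊢
    rw [map_add, ha, ha']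

/-- The ideal of the truncated polynomial algebra attached to an adapted family. -/
noncomputable def truncIdeal : Ideal (MvPolynomial B (ZMod p)) :=
  Ideal.span ((fun s => MvPolynomial.monomial s (1 : ZMod p)) ''
    Set.range fun b => Finsupp.single b (F.q b))

lemma coeff_eq_zero_of_mem_truncIdeal {f : MvPolynomial B (ZMod p)} (hf : f ∈ F.truncIdeal)
    {a : B →₀ ℕ} (ha : ∀ b, a b < F.q b) : f.coeff a = 0 := by
  by_contra h
  obtain ⟨_, ⟨b, rfl⟩, hb⟩ := MvPolynomial.mem_ideal_span_monomial_image.1 hf a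
    (MvPolynomial.mem_support_iff.2 h)
  rw [Finsupp.single_le_iff] at hb
  exact absurd hb (not_le.2 (ha b))

lemma q_ne_zero [Fact p.Prime] (b : B) : F.q b ≠ 0 := by
  obtain ⟨k, hk⟩ := F.exists_pow b
  rw [hk]
  exact pow_ne_zero _ (Fact.out : p.Prime).ne_zero

/-- Frobenius applies because `F.q b` is a power of `p`. This is what allows the generator of `ZMod
(F.q b)` to be sent to `1 + X b`. -/
lemma one_add_X_pow [Fact p.Prime] (b : B) :
    (1 + Ideal.Quotient.mk F.truncIdeal (MvPolynomial.X b)) ^ F.q b = 1 := by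
  obtain ⟨k, hk⟩ := F.exists_pow b
  have h : (1 + MvPolynomial.X b : MvPolynomial B (ZMod p)) ^ F.q b
      = 1 + MvPolynomial.X b ^ F.q b := by
    rw [hk, add_pow_char_pow, one_pow]
  rw [← map_one (Ideal.Quotient.mk F.truncIdeal), ← map_add, ← map_pow, h, map_add, map_one,
    add_eq_left, Ideal.Quotient.eq_zero_iff_mem]
  refine Ideal.subset_span ⟨_, ⟨b, rfl⟩, ?_⟩
  rw [MvPolynomial.X_pow_eq_monomial]

/-- The unit `1 + X b` of the truncated polynomial algebra. -/
noncomputable def unit [Fact p.Prime] (b : B) : (MvPolynomial B (ZMod p) ⧸ F.truncIdeal)ˣ :=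
  Units.ofPowEqOne _ _ (F.one_add_X_pow b) (F.q_ne_zero b)

/-- The homomorphism from the sum of the cyclic groups to the units of the truncated polynomial
algebra. -/
noncomputable def unitHom [Fact p.Prime] : (DirectSum B fun b => ZMod (F.q b)) →+
    Additive (MvPolynomial B (ZMod p) ⧸ F.truncIdeal)ˣ :=
  DirectSum.toAddMonoid (β := fun b => ZMod (F.q b))
    (γ := Additive (MvPolynomial B (ZMod p) ⧸ F.truncIdeal)ˣ) fun b => ZMod.lift (F.q b)
    ⟨zmultiplesHom _ (Additive.ofMul (F.unit b)), by
      rw [zmultiplesHom_apply, natCast_zsmul, ← ofMul_pow]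
      exact congrArg Additive.ofMul (Units.pow_ofPowEqOne _ _)⟩

lemma unitHom_of [Fact p.Prime] (b : B) (m : ℕ) :
    F.unitHom (DirectSum.of (fun b => ZMod (F.q b)) b m) = Additive.ofMul (F.unit b ^ m) := by
  have h := ZMod.lift_coe (F.q b) ⟨zmultiplesHom _ (Additive.ofMul (F.unit b)), by
      rw [zmultiplesHom_apply, natCast_zsmul, ← ofMul_pow]
      exact congrArg Additive.ofMul (Units.pow_ofPowEqOne _ _)⟩ (m : ℤ)
  rw [Int.cast_natCast] at h
  rw [unitHom, DirectSum.toAddMonoid_of, h]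
  simp

/-- The augmentation ideal of the truncated polynomial algebra. -/
noncomputable def truncMax : Ideal (MvPolynomial B (ZMod p) ⧸ F.truncIdeal) :=
  (MvPolynomial.idealOfVars B (ZMod p)).map (Ideal.Quotient.mk F.truncIdeal)

lemma unitHom_sub_one_mem [Fact p.Prime] (y : DirectSum B fun b => ZMod (F.q b)) :
    ((F.unitHom y).toMul : MvPolynomial B (ZMod p) ⧸ F.truncIdeal) - 1 ∈ F.truncMax := by
  induction y using DirectSum.induction_on with
  | zero => simp
  | of b x =>
    have : NeZero (F.q b) := ⟨F.q_ne_zero b⟩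
    rw [← ZMod.natCast_zmod_val x, unitHom_of, toMul_ofMul, Units.val_pow_eq_pow_val]
    have h := sub_dvd_pow_sub_pow (F.unit b : MvPolynomial B (ZMod p) ⧸ F.truncIdeal) 1
      (ZMod.val x)
    rw [one_pow] at h
    refine Ideal.mem_of_dvd _ h ?_
    rw [unit, Units.val_ofPowEqOne, add_sub_cancel_left]
    exact Ideal.mem_map_of_mem _ (Ideal.subset_span ⟨b, rfl⟩)
  | add x y hx hy =>
    rw [map_add, toMul_add, Units.val_mul]
    have h := Ideal.add_mem _ (Ideal.mul_mem_left _
      ((F.unitHom x).toMul : MvPolynomial B (ZMod p) ⧸ F.truncIdeal) hy) hx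
    convert h using 1
    ring

/-- The algebra homomorphism `[v] ↦ ∏ b, (1 + X b) ^ v_b`, where the `v_b` are the coordinates of
`v`, from `𝔽_p[V]` to the truncated polynomial algebra. -/
noncomputable def toTrunc [Fact p.Prime] : AddMonoidAlgebra (ZMod p) V →ₐ[ZMod p]
    MvPolynomial B (ZMod p) ⧸ F.truncIdeal :=
  AddMonoidAlgebra.lift (ZMod p) _ V
    ((Units.coeHom _).comp (AddMonoidHom.toMultiplicativeLeft (F.unitHom.comp F.coord)))

lemma toTrunc_single [Fact p.Prime] (v : V) : F.toTrunc (AddMonoidAlgebra.single v 1)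
    = ((F.unitHom (F.coord v)).toMul : MvPolynomial B (ZMod p) ⧸ F.truncIdeal) := by
  simp [toTrunc]

lemma toTrunc_mono [Fact p.Prime] (a : B →₀ ℕ) : F.toTrunc (F.mono a)
    = Ideal.Quotient.mk F.truncIdeal (MvPolynomial.monomial a 1) := by
  rw [MvPolynomial.monomial_eq, MvPolynomial.C_1, one_mul, Finsupp.prod, mono, Finsupp.prod,
    map_prod, map_prod]
  refine Finset.prod_congr rfl fun b _ => ?_
  have h := F.unitHom_of b 1
  rw [Nat.cast_one, pow_one] at h
  rw [map_pow, map_pow, map_sub, map_one, toTrunc_single, F.coord_v, h, toMul_ofMul, unit,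
    Units.val_ofPowEqOne, add_sub_cancel_left]

lemma toTrunc_mem [Fact p.Prime] {f : AddMonoidAlgebra (ZMod p) V} (hf : f ∈ augIdeal p V) :
    F.toTrunc f ∈ F.truncMax := by
  have hle : Submodule.span (ZMod p)
      (Set.range fun v : V => (AddMonoidAlgebra.single v 1 - 1 : AddMonoidAlgebra (ZMod p) V)) ≤
      (F.truncMax.restrictScalars (ZMod p)).comap F.toTrunc.toLinearMap := by
    rw [Submodule.span_le]
    rintro _ ⟨v, rfl⟩
    change F.toTrunc _ ∈ F.truncMax
    rw [map_sub, map_one, toTrunc_single]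
    exact F.unitHom_sub_one_mem _
  exact hle (augIdeal_le_span hf)

/-- The monomials of degree `m` with small exponents are independent modulo `I ^ (m + 1)`. -/
lemma coeff_eq_zero_of_sum_mem [Fact p.Prime] {m : ℕ} (s : Finset (B →₀ ℕ))
    (hs : ∀ a ∈ s, ∀ b, a b < F.q b) (g : (B →₀ ℕ) → ZMod p)
    (h : ∑ a ∈ s, g a • F.mono a ∈ augIdeal p V ^ (m + 1)) :
    ∀ a ∈ s, a.degree ≤ m → g a = 0 := by
  intro a ha ham
  have hle : (augIdeal p V ^ (m + 1)).map F.toTrunc ≤ F.truncMax ^ (m + 1) := by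
    rw [Ideal.map_pow]
    refine Ideal.pow_right_mono ?_ _
    exact Ideal.map_le_iff_le_comap.2 fun f (hf : f ∈ augIdeal p V) => F.toTrunc_mem hf
  have h1 := hle (Ideal.mem_map_of_mem F.toTrunc h)
  rw [truncMax, ← Ideal.map_pow,
    Ideal.mem_map_iff_of_surjective _ Ideal.Quotient.mk_surjective] at h1
  obtain ⟨f, hf, hfe⟩ := h1
  have h2 : F.toTrunc (∑ a ∈ s, g a • F.mono a)
      = Ideal.Quotient.mk F.truncIdeal (∑ a ∈ s, MvPolynomial.monomial a (g a)) := by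
    rw [map_sum, map_sum]
    refine Finset.sum_congr rfl fun a _ => ?_
    rw [map_smul, toTrunc_mono, ← Ideal.Quotient.mkₐ_eq_mk (ZMod p), ← map_smul,
      MvPolynomial.smul_monomial, smul_eq_mul, mul_one]
  -- The polynomial `f` has no terms of degree at most `m`, and it differs from the given
  -- combination by an element of a monomial ideal that has no terms at truncated exponents. The
  -- coefficient at `a` can thus be read off as zero.
  rw [h2, Ideal.Quotient.eq] at hfe
  have h3 := F.coeff_eq_zero_of_mem_truncIdeal hfe (hs a ha)
  rw [MvPolynomial.coeff_sub, (MvPolynomial.mem_pow_idealOfVars_iff' _ _).1 hf a (by omega),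
    MvPolynomial.coeff_sum] at h3
  simpa [MvPolynomial.coeff_monomial, ha] using h3

end AdaptedFamily

end Monomials

/-! ### Monomial basis of the graded pieces, and division by a generator. -/

namespace AdaptedFamily

variable {p : ℕ} {V : Type u} [AddCommGroup V] {t n : ℕ} {B : Type*} [DecidableEq B]
  (F : AdaptedFamily p V t n B)

lemma mono_mem_filt {m : ℤ} {a : B →₀ ℕ} (h : (a.degree : ℤ) = m) : F.mono a ∈ filt p V m := by
  subst h
  exact F.mono_mem a

/-- The class in `S^m` of the monomial of exponent `a`, or zero if the degree is not `m`. -/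
noncomputable def cls (m : ℤ) (a : B →₀ ℕ) : S p V m :=
  if h : (a.degree : ℤ) = m then
    Submodule.Quotient.mk ⟨F.mono a, F.mono_mem_filt h⟩
  else 0

lemma cls_eq_zero [Fact p.Prime] {m : ℤ} (hm : m ≤ n) {a : B →₀ ℕ} {b : B} (hb : F.q b ≤ a b) :
    F.cls m a = 0 := by
  rw [cls]
  split_ifs with h
  · refine (Submodule.Quotient.mk_eq_zero _).2 ?_
    have h0 : F.mono a = 0 := F.mono_eq_zero (by omega) hb
    simp only [h0]
    exact Submodule.zero_mem _
  · rfl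

lemma mulV_cls {j k : ℤ} (h : j + 1 = k) (a : B →₀ ℕ) (b : B) :
    mulV h (F.cls j a) (F.v b) = F.cls k (a + Finsupp.single b 1) := by
  have hdeg : (((a + Finsupp.single b 1).degree : ℕ) : ℤ) = (a.degree : ℤ) + 1 := by
    rw [map_add, Finsupp.degree_single]; push_cast; rfl
  by_cases ha : (a.degree : ℤ) = j
  · rw [cls, cls, dif_pos ha, dif_pos (by omega)]
    refine congrArg Submodule.Quotient.mk (Subtype.ext ?_)
    change F.mono a * _ = F.mono _
    rw [mono_add, mono_single, pow_one]
  · rw [cls, cls, dif_neg ha, dif_neg (by omega)]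
    simp

/-- The exponents of degree `m` of the truncated polynomial algebra. -/
abbrev Exponent (m : ℤ) : Type _ :=
  {a : B →₀ ℕ // (∀ b, a b < F.q b) ∧ (a.degree : ℤ) = m}

/-- No bound on `m` is needed: the comparison map `toTrunc` uses only the coordinates, not the
relations `q b • v b = 0`. -/
lemma linearIndependent_cls [Fact p.Prime] (m : ℤ) :
    LinearIndependent (ZMod p) fun a : F.Exponent m => F.cls m a.1 := by
  classical
  rw [linearIndependent_iff']
  intro s g hg a ha
  obtain ⟨k, rfl⟩ : ∃ k : ℕ, m = k := ⟨_, a.2.2.symm⟩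
  have h1 : ∑ c ∈ s, g c • F.cls (k : ℤ) c.1
      = Submodule.Quotient.mk (∑ c ∈ s, g c • (⟨F.mono c.1, F.mono_mem_filt c.2.2⟩ : filt p V k)) := by
    rw [← Submodule.mkQ_apply, map_sum]
    refine Finset.sum_congr rfl fun c _ => ?_
    rw [cls, dif_pos c.2.2, map_smul]
    rfl
  rw [h1, Submodule.Quotient.mk_eq_zero] at hg
  let emb : F.Exponent k ↪ (B →₀ ℕ) := ⟨Subtype.val, Subtype.val_injective⟩
  let g' : (B →₀ ℕ) → ZMod p := Function.extend emb g 0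
  have hg' : ∀ c, g' (emb c) = g c := fun c => emb.injective.extend_apply _ _ _
  have hmem : ∑ c ∈ s.map emb, g' c • F.mono c ∈ augIdeal p V ^ (k + 1) := by
    rw [Finset.sum_map]
    simp only [hg']
    have h2 : (∑ c ∈ s, g c • F.mono c.1) ∈ filt p V ((k : ℤ) + 1) := by
      have h3 : ((filt p V k).subtype (∑ c ∈ s, g c •
          (⟨F.mono c.1, F.mono_mem_filt c.2.2⟩ : filt p V k))) ∈ filt p V ((k : ℤ) + 1) := hg
      simpa using h3
    exact h2
  have := F.coeff_eq_zero_of_sum_mem (s.map emb) (by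
    intro c hc
    obtain ⟨c', _, rfl⟩ := Finset.mem_map.1 hc
    exact c'.2.1) g' hmem (emb a) (Finset.mem_map_of_mem _ ha) (by
      have := a.2.2
      change a.1.degree ≤ k
      omega)
  rwa [hg'] at this

/-- The bound on `m` matters here: when `q b > n` the element `v b` need not be killed by `q b`, but
an exponent that large cannot occur in degree at most `n`. -/
lemma top_le_span_cls [Fact p.Prime] {m : ℤ} (hm : m ≤ n) :
    ⊤ ≤ Submodule.span (ZMod p) (Set.range fun a : F.Exponent m => F.cls m a.1) := by
  rcases lt_or_ge m 0 with h | h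
  · have := subsingleton_S (p := p) (V := V) h
    intro x _
    rw [Subsingleton.elim x 0]
    exact Submodule.zero_mem _
  obtain ⟨k, rfl⟩ := Int.eq_ofNat_of_zero_le h
  intro x _
  induction x using Submodule.Quotient.induction_on with
  | _ x =>
  obtain ⟨x, hx⟩ := x
  have hx' : x ∈ (augIdeal p V ^ k).restrictScalars (ZMod p) := hx
  obtain ⟨y, hy, z, hz, rfl⟩ := Submodule.mem_sup.1 (F.augIdeal_pow_le k hx')
  have hfilt : ∀ a : B →₀ ℕ, a.degree = k → F.mono a ∈ filt p V (k : ℤ) :=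
    fun a ha => F.mono_mem_filt (by rw [ha])
  have hspan : ∀ y, y ∈ Submodule.span (ZMod p) (F.mono '' {a | a.degree = k}) →
      ∃ hy : y ∈ filt p V (k : ℤ), (Submodule.Quotient.mk ⟨y, hy⟩ : S p V k) ∈
        Submodule.span (ZMod p) (Set.range fun a : F.Exponent k => F.cls k a.1) := by
    intro y hy
    induction hy using Submodule.span_induction with
    | mem y hy =>
      obtain ⟨a, ha, rfl⟩ := hy
      refine ⟨hfilt a ha, ?_⟩
      have hc : (Submodule.Quotient.mk ⟨F.mono a, hfilt a ha⟩ : S p V k) = F.cls k a := by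
        rw [cls, dif_pos (by exact_mod_cast ha)]
      rw [hc]
      by_cases hq : ∀ b, a b < F.q b
      · exact Submodule.subset_span ⟨⟨a, hq, by exact_mod_cast ha⟩, rfl⟩
      · push Not at hq
        obtain ⟨b, hb⟩ := hq
        rw [F.cls_eq_zero hm hb]
        exact Submodule.zero_mem _
    | zero => exact ⟨Submodule.zero_mem _, Submodule.zero_mem _⟩
    | add y z _ _ hy hz =>
      obtain ⟨hy, hy'⟩ := hy
      obtain ⟨hz, hz'⟩ := hz
      exact ⟨Submodule.add_mem _ hy hz, Submodule.add_mem _ hy' hz'⟩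
    | smul c y _ hy =>
      obtain ⟨hy, hy'⟩ := hy
      exact ⟨Submodule.smul_mem _ c hy, Submodule.smul_mem _ c hy'⟩
  obtain ⟨hy', hyS⟩ := hspan y hy
  convert hyS using 1
  rw [Submodule.Quotient.eq]
  change y + z - y ∈ filt p V (k + 1)
  rw [add_sub_cancel_left]
  exact hz

/-- The monomial basis of `S^m`. -/
noncomputable def basis [Fact p.Prime] {m : ℤ} (hm : m ≤ n) :
    Module.Basis (F.Exponent m) (ZMod p) (S p V m) :=
  Module.Basis.mk (F.linearIndependent_cls m) (F.top_le_span_cls hm)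

/-- Division of monomials by `[v b] - 1`. -/
noncomputable def div [Fact p.Prime] {k : ℤ} (j : ℤ) (hk : k ≤ n) (b : B) :
    S p V k →ₗ[ZMod p] S p V j :=
  (F.basis hk).constr (ZMod p) fun a =>
    if a.1 b = 0 then 0 else F.cls j (a.1 - Finsupp.single b 1)

lemma div_cls [Fact p.Prime] {j k : ℤ} (hk : k ≤ n) (b : B) (a : F.Exponent k) :
    F.div j hk b (F.cls k a.1) =
      if a.1 b = 0 then 0 else F.cls j (a.1 - Finsupp.single b 1) := by
  have h : F.cls k a.1 = F.basis hk a := by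
    rw [basis, Module.Basis.mk_apply]
  rw [h, div, Module.Basis.constr_basis]

lemma mulV_div_cls [Fact p.Prime] {j k : ℤ} (h : j + 1 = k) (hk : k ≤ n) (b : B)
    (a : F.Exponent k) :
    mulV h (F.div j hk b (F.cls k a.1)) (F.v b) = if a.1 b = 0 then 0 else F.cls k a.1 := by
  rw [div_cls]
  split_ifs with hb
  · simp
  · rw [mulV_cls, tsub_add_cancel_of_le]
    rw [Finsupp.single_le_iff]
    omega

/-- At the top exponent `q b - 1` multiplication by `v b` gives zero. This is the only obstruction
to cancelling, and the source of the classes `X^(q-1) e`. -/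
lemma div_mulV_cls [Fact p.Prime] {j k : ℤ} (h : j + 1 = k) (hk : k ≤ n) (b : B)
    (a : F.Exponent j) :
    F.div j hk b (mulV h (F.cls j a.1) (F.v b)) =
      if a.1 b + 1 < F.q b then F.cls j a.1 else 0 := by
  rw [mulV_cls]
  split_ifs with hb
  · have ha : ∀ c, (a.1 + Finsupp.single b 1 : B →₀ ℕ) c < F.q c := by
      intro c
      by_cases hc : c = b
      · subst hc; simpa using hb
      · simpa [Finsupp.single_apply, Ne.symm hc] using a.2.1 c
    have hd : (((a.1 + Finsupp.single b 1).degree : ℕ) : ℤ) = k := by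
      rw [map_add, Finsupp.degree_single]; push_cast; rw [a.2.2, h]
    rw [F.div_cls hk b ⟨_, ha, hd⟩]
    simp
  · rw [F.cls_eq_zero hk (b := b), map_zero]
    simp only [Finsupp.add_apply, Finsupp.single_eq_same]
    omega

lemma div_mulV_cls_of_ne [Fact p.Prime] {i j k : ℤ} (h : i + 1 = j) (h' : j + 1 = k) (hj : j ≤ n)
    (hk : k ≤ n) {b c : B} (hbc : c ≠ b) (a : F.Exponent j) :
    F.div j hk b (mulV h' (F.cls j a.1) (F.v c)) =
      mulV h (F.div i hj b (F.cls j a.1)) (F.v c) := by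
  rw [mulV_cls, div_cls]
  by_cases hc : a.1 c + 1 < F.q c
  · have ha : ∀ e, (a.1 + Finsupp.single c 1 : B →₀ ℕ) e < F.q e := by
      intro e
      by_cases he : e = c
      · subst he; simpa using hc
      · simpa [Finsupp.single_apply, Ne.symm he] using a.2.1 e
    have hd : (((a.1 + Finsupp.single c 1).degree : ℕ) : ℤ) = k := by
      rw [map_add, Finsupp.degree_single]; push_cast; rw [a.2.2, h']
    rw [F.div_cls hk b ⟨_, ha, hd⟩]
    simp only [Finsupp.add_apply, Finsupp.single_apply, hbc, if_false, add_zero]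
    split_ifs with hb
    · simp
    · rw [mulV_cls, tsub_add_eq_add_tsub]
      rw [Finsupp.single_le_iff]
      omega
  -- The exponent of `c` overflows on both sides, since dividing by `b ≠ c` leaves it unchanged.
  · rw [F.cls_eq_zero hk (b := c) (by simp; omega), map_zero]
    split_ifs with hb
    · simp
    · rw [mulV_cls, F.cls_eq_zero hj (b := c)]
      simp only [Finsupp.add_apply, Finsupp.tsub_apply, Finsupp.single_apply, hbc.symm, if_false,
        if_true]
      omega

end AdaptedFamily

/-! ### Homotopies of Koszul type and a criterion for exactness. -/

section Homotopy

variable {R K : Type*} [CommRing R] [CommRing K] [Algebra R K]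
  {M : Type*} [AddCommGroup M] [Module R M]
  {N N' N'' : Type*}
  [AddCommGroup N] [Module R N] [Module K N] [IsScalarTower R K N]
  [AddCommGroup N'] [Module R N'] [Module K N'] [IsScalarTower R K N']
  [AddCommGroup N''] [Module R N''] [Module K N''] [IsScalarTower R K N'']

/-- Left exterior multiplication by `u`. -/
noncomputable def wedgeLeft (R : Type*) [CommRing R] {M : Type*} [AddCommGroup M] [Module R M]
    (u : M) (i : ℕ) : (⋀[R]^i M) →ₗ[R] (⋀[R]^(i + 1) M) :=
  exteriorPower.alternatingMapLinearEquiv ((exteriorPower.ιMulti R (i + 1)).curryLeft u)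

lemma wedgeLeft_ιMulti (u : M) (i : ℕ) (w : Fin i → M) :
    wedgeLeft R u i (exteriorPower.ιMulti R i w)
      = exteriorPower.ιMulti R (i + 1) (Matrix.vecCons u w) := by
  simp [wedgeLeft]

/-- The homotopy `s ⊗ x ↦ (-1)^i D s ⊗ (u ∧ x)`. -/
noncomputable def wedgeStep (D : N →ₗ[K] N') (u : M) (i : ℕ) :
    KTerm R M N i →ₗ[K] KTerm R M N' (i + 1) :=
  (-1 : K) ^ i • TensorProduct.AlgebraTensorModule.map D (wedgeLeft R u i)

lemma wedgeStep_tmul_ιMulti (D : N →ₗ[K] N') (u : M) (i : ℕ) (s : N) (w : Fin i → M) :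
    wedgeStep (R := R) D u i (s ⊗ₜ[R] exteriorPower.ιMulti R i w)
      = (-1 : ℤ) ^ i • (D s ⊗ₜ[R] exteriorPower.ιMulti R (i + 1) (Matrix.vecCons u w)) := by
  rw [wedgeStep, LinearMap.smul_apply, TensorProduct.AlgebraTensorModule.map_tmul,
    wedgeLeft_ιMulti]
  rcases Nat.even_or_odd i with h | h
  · simp [h.neg_one_pow]
  · simp [h.neg_one_pow]

lemma koszulStep_tmul_ιMulti_int (μ : N →ₗ[K] M →ₗ[R] N') (i : ℕ) (s : N) (v : Fin (i + 1) → M) :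
    koszulStep μ i (s ⊗ₜ[R] exteriorPower.ιMulti R (i + 1) v)
      = (-1 : ℤ) ^ i • ∑ l : Fin (i + 1), (-1 : ℤ) ^ (l : ℕ) •
          (μ s (v l) ⊗ₜ[R] exteriorPower.ιMulti R i (l.removeNth v)) := by
  rw [koszulStep_tmul_ιMulti]
  rcases Nat.even_or_odd i with h | h
  · simp [h.neg_one_pow]
  · simp [h.neg_one_pow]

lemma neg_one_pow_smul_smul {X : Type*} [AddCommGroup X] (i : ℕ) (x : X) :
    (-1 : ℤ) ^ i • (-1 : ℤ) ^ i • x = x := by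
  rw [smul_smul, ← mul_pow]
  simp

lemma neg_one_pow_smul_sum {X : Type*} [AddCommGroup X] (i : ℕ) {k : ℕ} (f : Fin k → X) :
    (-1 : ℤ) ^ i • ∑ l : Fin k, (-1 : ℤ) ^ (l : ℕ) • (-1 : ℤ) ^ i • f l
      = ∑ l : Fin k, (-1 : ℤ) ^ (l : ℕ) • f l := by
  rw [Finset.smul_sum]
  refine Finset.sum_congr rfl fun l _ => ?_
  rw [smul_comm ((-1 : ℤ) ^ (l : ℕ)), neg_one_pow_smul_smul]

lemma removeNth_succ_vecCons {M : Type*} {i : ℕ} (u : M) (w : Fin (i + 1) → M) (l : Fin (i + 1)) :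
    l.succ.removeNth (Matrix.vecCons u w) = Matrix.vecCons u (l.removeNth w) := by
  ext k
  refine Fin.cases ?_ (fun k => ?_) k
  · simp [Fin.removeNth]
  · simp [Fin.removeNth]

/-- In degree zero, the Koszul differential of the homotopy is a multiplication. -/
lemma koszulStep_wedgeStep_zero (ν : N'' →ₗ[K] M →ₗ[R] N) (D : N →ₗ[K] N'') (u : M) (s : N)
    (w : Fin 0 → M) :
    koszulStep ν 0 (wedgeStep D u 0 (s ⊗ₜ[R] exteriorPower.ιMulti R 0 w))
      = ν (D s) u ⊗ₜ[R] exteriorPower.ιMulti R 0 w := by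
  rw [wedgeStep_tmul_ιMulti, map_zsmul, koszulStep_tmul_ιMulti_int]
  simp only [pow_zero, one_smul, Fin.sum_univ_succ, Finset.univ_eq_empty, Finset.sum_empty,
    add_zero, Fin.val_zero, Matrix.cons_val_zero]
  congr 2

/-- The commutation formula of the Koszul differential and the homotopy. -/
lemma koszulStep_wedgeStep_add (μ : N →ₗ[K] M →ₗ[R] N') (ν : N'' →ₗ[K] M →ₗ[R] N)
    (D : N →ₗ[K] N'') (D' : N' →ₗ[K] N) (u : M) (i : ℕ) (s : N) (w : Fin (i + 1) → M) :
    koszulStep ν (i + 1) (wedgeStep D u (i + 1) (s ⊗ₜ[R] exteriorPower.ιMulti R (i + 1) w))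
      + wedgeStep D' u i (koszulStep μ i (s ⊗ₜ[R] exteriorPower.ιMulti R (i + 1) w))
      = ν (D s) u ⊗ₜ[R] exteriorPower.ιMulti R (i + 1) w
        + ∑ l : Fin (i + 1), (D' (μ s (w l)) - ν (D s) (w l)) ⊗ₜ[R]
          ((-1 : ℤ) ^ (l : ℕ) •
            exteriorPower.ιMulti R (i + 1) (Matrix.vecCons u (l.removeNth w))) := by
  rw [wedgeStep_tmul_ιMulti, map_zsmul, koszulStep_tmul_ιMulti_int, neg_one_pow_smul_smul,
    koszulStep_tmul_ιMulti_int, map_zsmul, map_sum, Fin.sum_univ_succ]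
  simp only [map_zsmul, wedgeStep_tmul_ιMulti]
  rw [neg_one_pow_smul_sum]
  simp only [Fin.val_zero, pow_zero, one_smul, Matrix.cons_val_zero, Matrix.cons_val_succ,
    removeNth_succ_vecCons, Fin.val_succ, pow_succ, mul_neg, mul_one, neg_smul,
    TensorProduct.sub_tmul, TensorProduct.tmul_smul, smul_sub, Finset.sum_sub_distrib,
    Finset.sum_neg_distrib]
  rw [show (0 : Fin (i + 2)).removeNth (Matrix.vecCons u w) = w from rfl]
  abel

/-- The homotopy formula on a tensor none of whose exterior factors is `u`. -/
lemma koszulStep_wedgeStep_add_of_comm (μ : N →ₗ[K] M →ₗ[R] N') (ν : N'' →ₗ[K] M →ₗ[R] N)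
    (D : N →ₗ[K] N'') (D' : N' →ₗ[K] N) (u : M) (i : ℕ) (s : N) (w : Fin (i + 1) → M)
    (h : ∀ l, D' (μ s (w l)) = ν (D s) (w l)) :
    koszulStep ν (i + 1) (wedgeStep D u (i + 1) (s ⊗ₜ[R] exteriorPower.ιMulti R (i + 1) w))
      + wedgeStep D' u i (koszulStep μ i (s ⊗ₜ[R] exteriorPower.ιMulti R (i + 1) w))
      = ν (D s) u ⊗ₜ[R] exteriorPower.ιMulti R (i + 1) w := by
  rw [koszulStep_wedgeStep_add, add_eq_left]
  refine Finset.sum_eq_zero fun l _ => ?_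
  rw [h, sub_self, TensorProduct.zero_tmul]

/-- The homotopy formula on a tensor exactly one of whose exterior factors is `u`. -/
lemma koszulStep_wedgeStep_add_of_eq (μ : N →ₗ[K] M →ₗ[R] N') (ν : N'' →ₗ[K] M →ₗ[R] N)
    (D : N →ₗ[K] N'') (D' : N' →ₗ[K] N) (i : ℕ) (s : N) (w : Fin (i + 1) → M)
    (l₀ : Fin (i + 1)) (h : ∀ l ≠ l₀, D' (μ s (w l)) = ν (D s) (w l)) :
    koszulStep ν (i + 1) (wedgeStep D (w l₀) (i + 1)
        (s ⊗ₜ[R] exteriorPower.ιMulti R (i + 1) w))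
      + wedgeStep D' (w l₀) i (koszulStep μ i (s ⊗ₜ[R] exteriorPower.ιMulti R (i + 1) w))
      = D' (μ s (w l₀)) ⊗ₜ[R] exteriorPower.ιMulti R (i + 1) w := by
  -- Moving the factor `w l₀` to the front costs the sign `(-1) ^ l₀`, which cancels the sign of the
  -- single surviving term.
  have hs := (exteriorPower.ιMulti R (M := M) (i + 1)).neg_one_pow_smul_map_insertNth l₀ (w l₀)
    (l₀.removeNth w)
  rw [Fin.insertNth_self_removeNth] at hs
  rw [koszulStep_wedgeStep_add, Finset.sum_eq_single l₀]
  · rw [← hs, neg_one_pow_smul_smul, TensorProduct.sub_tmul]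
    abel
  · intro l _ hl
    rw [h l hl, sub_self, TensorProduct.zero_tmul]
  · simp

/-- If every member of a spanning family is fixed by an operator that is diagonal on the family
and maps `Z` to boundaries, then all elements of `Z` are boundaries. -/
lemma le_range_of_diagonal {X Y ι : Type*} [AddCommGroup X] [Module K X] [AddCommGroup Y]
    [Module K Y] (d : Y →ₗ[K] X) (Z : Submodule K X) (hd : LinearMap.range d ≤ Z) (x : ι → X)
    (hx : Submodule.span K (Set.range x) = ⊤)
    (hE : ∀ i, ∃ E : X →ₗ[K] X, (∀ z ∈ Z, E z ∈ LinearMap.range d) ∧ E (x i) = x i ∧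
      ∀ j, ∃ c : K, E (x j) = c • x j) :
    Z ≤ LinearMap.range d := by
  classical
  have key : ∀ (s : Finset ι), ∀ z ∈ Z, z ∈ Submodule.span K (x '' s) → z ∈ LinearMap.range d := by
    intro s
    induction s using Finset.induction_on with
    | empty =>
      intro z _ hz
      rw [Finset.coe_empty, Set.image_empty, Submodule.span_empty, Submodule.mem_bot] at hz
      rw [hz]
      exact Submodule.zero_mem _
    | insert i s _ ih =>
      intro z hz hzs
      obtain ⟨E, hE1, hE2, hE3⟩ := hE i
      -- `z - E z` is still in `Z` and no longer involves `x i`, while the other members of the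
      -- family are only rescaled. Independence of the family plays no role.
      rw [← sub_add_cancel z (E z)]
      refine Submodule.add_mem _ (ih _ (Submodule.sub_mem _ hz (hd (hE1 z hz))) ?_) (hE1 z hz)
      rw [Finset.coe_insert, Set.image_insert_eq] at hzs
      obtain ⟨c, y, hy, rfl⟩ := Submodule.mem_span_insert.1 hzs
      have hEy : Submodule.span K (x '' s) ≤ (Submodule.span K (x '' s)).comap E := by
        rw [Submodule.span_le]
        rintro _ ⟨j, hj, rfl⟩
        obtain ⟨c, hc⟩ := hE3 j
        rw [SetLike.mem_coe, Submodule.mem_comap, hc]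
        exact Submodule.smul_mem _ _ (Submodule.subset_span ⟨j, hj, rfl⟩)
      rw [map_add, map_smul, hE2, add_sub_add_left_eq_sub]
      exact Submodule.sub_mem _ hy (hEy hy)
  intro z hz
  have hz' : z ∈ Submodule.span K (Set.range x) := by rw [hx]; trivial
  obtain ⟨l, rfl⟩ := (Finsupp.mem_span_range_iff_exists_finsupp).1 hz'
  refine key l.support _ hz ?_
  exact Submodule.sum_mem _ fun i hi => Submodule.smul_mem _ _ (Submodule.subset_span ⟨i, hi, rfl⟩)

end Homotopy

/-! ### Spanning families of the terms of the complex. -/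

section Span

variable {p : ℕ} {V : Type*} [AddCommGroup V] {B : Type*} {v : B → V}

/-- A multilinear map that is killed by `p` takes its values in a submodule as soon as it does so on
a family spanning modulo `p`. -/
lemma map_mem_of_closure_eq_top {X : Type*} [AddCommGroup X] (T : AddSubgroup X) {i : ℕ}
    (f : V [⋀^Fin i]→ₗ[ℤ] X) (hpX : ∀ x : X, p • x = 0)
    (hcl : AddSubgroup.closure (Set.range v ∪ Set.range fun u : V => p • u) = ⊤)
    (hf : ∀ σ : Fin i → B, f (v ∘ σ) ∈ T) (w : Fin i → V) : f w ∈ T := by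
  classical
  -- The entries are replaced by members of the family one at a time; `A` is the set of positions
  -- still arbitrary.
  have key : ∀ (A : Finset (Fin i)) (w : Fin i → V), (∀ l ∉ A, w l ∈ Set.range v) → f w ∈ T := by
    intro A
    induction A using Finset.induction_on with
    | empty =>
      intro w hw
      choose σ hσ using fun l => hw l (Finset.notMem_empty l)
      rw [show w = v ∘ σ from funext fun l => (hσ l).symm]
      exact hf σ
    | insert l A _ ih =>
      intro w hw
      suffices h : ∀ y : V, f (Function.update w l y) ∈ T by
        simpa using h (w l)
      intro y
      have hy : y ∈ AddSubgroup.closure (Set.range v ∪ Set.range fun u : V => p • u) := by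
        rw [hcl]; trivial
      induction hy using AddSubgroup.closure_induction with
      | mem y hy =>
        rcases hy with hy | ⟨u, rfl⟩
        · refine ih _ fun k hk => ?_
          by_cases hkl : k = l
          · subst hkl
            simpa using hy
          · rw [Function.update_of_ne hkl]
            exact hw k (by simp [hkl, hk])
        · have h := f.map_update_smul w l (p : ℤ) u
          rw [natCast_zsmul, natCast_zsmul, hpX] at h
          simp only
          rw [h]
          exact T.zero_mem
      | zero => rw [f.map_update_zero]; exact T.zero_mem
      | add y z _ _ hy hz => rw [f.map_update_add]; exact T.add_mem hy hz
      | neg y _ hy =>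
        have h := f.map_update_smul w l (-1) y
        rw [neg_one_smul, neg_one_smul] at h
        rw [h]
        exact T.neg_mem hy
  exact key Finset.univ w fun l hl => absurd (Finset.mem_univ l) hl

/-- The tensor product is killed by `p`, so generators of `V` modulo `p` suffice in the exterior
factors; tuples with a repeated index vanish by alternation. -/
lemma span_tmul_ιMulti {N : Type*} [AddCommGroup N] [Module (ZMod p) N] {ι : Type*} {x : ι → N}
    (hx : ⊤ ≤ Submodule.span (ZMod p) (Set.range x))
    (hcl : AddSubgroup.closure (Set.range v ∪ Set.range fun u : V => p • u) = ⊤) (i : ℕ) :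
    Submodule.span (ZMod p) (Set.range fun τ : ι × {σ : Fin i → B // Function.Injective σ} =>
      (x τ.1 ⊗ₜ[ℤ] exteriorPower.ιMulti ℤ i (v ∘ τ.2.1) : KTerm ℤ V N i)) = ⊤ := by
  set T := Submodule.span (ZMod p) (Set.range fun τ : ι × {σ : Fin i → B // Function.Injective σ} =>
      (x τ.1 ⊗ₜ[ℤ] exteriorPower.ιMulti ℤ i (v ∘ τ.2.1) : KTerm ℤ V N i)) with hT
  have hp : ∀ y : KTerm ℤ V N i, p • y = 0 := by
    intro y
    rw [← Nat.cast_smul_eq_nsmul (ZMod p), CharP.cast_eq_zero, zero_smul]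
  have h1 : ∀ (j : ι) (w : Fin i → V), x j ⊗ₜ[ℤ] exteriorPower.ιMulti ℤ i w ∈ T := by
    intro j w
    refine map_mem_of_closure_eq_top T.toAddSubgroup
      ((TensorProduct.mk ℤ N (⋀[ℤ]^i V) (x j)).compAlternatingMap (exteriorPower.ιMulti ℤ i))
      hp hcl (fun σ => ?_) w
    by_cases hσ : Function.Injective σ
    · exact Submodule.subset_span ⟨(j, ⟨σ, hσ⟩), rfl⟩
    · have h0 : exteriorPower.ιMulti ℤ i (v ∘ σ) = 0 :=
        AlternatingMap.map_eq_zero_of_not_injective _ _ fun h => hσ h.of_comp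
      have h : (x j ⊗ₜ[ℤ] exteriorPower.ιMulti ℤ i (v ∘ σ) : KTerm ℤ V N i) ∈ T := by
        rw [h0, TensorProduct.tmul_zero]
        exact T.zero_mem
      exact h
  have h2 : ∀ (s : N) (w : Fin i → V), s ⊗ₜ[ℤ] exteriorPower.ιMulti ℤ i w ∈ T := by
    intro s w
    have hs := hx (show s ∈ ⊤ from trivial)
    induction hs using Submodule.span_induction with
    | mem s hs =>
      obtain ⟨j, rfl⟩ := hs
      exact h1 j w
    | zero => rw [TensorProduct.zero_tmul]; exact T.zero_mem
    | add s s' _ _ hs hs' => rw [TensorProduct.add_tmul]; exact T.add_mem hs hs'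
    | smul c s _ hs => rw [← TensorProduct.smul_tmul']; exact T.smul_mem c hs
  refine eq_top_iff.2 fun y _ => ?_
  clear * - h2
  induction y with
  | zero => exact T.zero_mem
  | add y z hy hz => exact T.add_mem hy hz
  | tmul s y =>
    have hy : y ∈ Submodule.span ℤ (Set.range (exteriorPower.ιMulti ℤ i (M := V))) := by
      rw [exteriorPower.ιMulti_span]; trivial
    induction hy using Submodule.span_induction with
    | mem y hy =>
      obtain ⟨w, rfl⟩ := hy
      exact h2 s w
    | zero => rw [TensorProduct.tmul_zero]; exact T.zero_mem
    | add y z _ _ hy hz => rw [TensorProduct.tmul_add]; exact T.add_mem hy hz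
    | smul c y _ hy =>
      rw [TensorProduct.tmul_smul]
      exact T.toAddSubgroup.zsmul_mem hy c

end Span

/-! ### Exactness in the range of the theorem. -/

namespace AdaptedFamily

variable {p : ℕ} {V : Type u} [AddCommGroup V] {t n : ℕ} {B : Type*} [DecidableEq B]
  (F : AdaptedFamily p V t n B)

/-- The basis tensors of the Koszul complex. -/
noncomputable def tensor (i : ℕ)
    (τ : F.Exponent ((n : ℤ) - i) × {σ : Fin i → B // Function.Injective σ}) :
    koszulX p V n i :=
  F.cls _ τ.1.1 ⊗ₜ[ℤ] exteriorPower.ιMulti ℤ i (F.v ∘ τ.2.1)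

lemma span_tensor [Fact p.Prime] (i : ℕ) :
    Submodule.span (ZMod p) (Set.range (F.tensor i)) = ⊤ :=
  span_tmul_ιMulti (F.top_le_span_cls (by omega)) F.closure_eq i

/-- A basis tensor is moved by the homotopy of `b` when its degree in `b` is neither zero nor
maximal. -/
def Moves {m : ℤ} {i : ℕ} (b : B)
    (τ : F.Exponent m × {σ : Fin i → B // Function.Injective σ}) : Prop :=
  (b ∉ Set.range τ.2.1 ∧ τ.1.1 b ≠ 0) ∨ (b ∈ Set.range τ.2.1 ∧ τ.1.1 b + 1 < F.q b)

/-- In the range of the theorem every basis tensor is moved by some homotopy. -/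
lemma exists_moves {i : ℕ} (hn : t * i < n)
    (τ : F.Exponent ((n : ℤ) - i) × {σ : Fin i → B // Function.Injective σ}) :
    ∃ b, F.Moves b τ := by
  classical
  by_contra! h
  obtain ⟨⟨a, haq, had⟩, ⟨σ, hσ⟩⟩ := τ
  simp only [Moves, not_or, not_and, not_not, not_lt] at h
  -- A tensor moved by no `b` has exponent zero off the image of `σ` and top exponent `q - 1` on it:
  -- it is a product of `i` classes `X^(q-1) e`.
  have hsum : a.degree = ∑ l : Fin i, a (σ l) := by
    rw [Finsupp.degree_apply, ← Finset.sum_image (s := Finset.univ) (g := σ) (f := fun b => a b)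
      fun x _ y _ hxy => hσ hxy]
    refine Finset.sum_subset (fun b hb => ?_) fun b _ hb => by simpa using hb
    by_contra hb'
    refine Finsupp.mem_support_iff.1 hb ((h b).1 fun ⟨l, hl⟩ => hb' ?_)
    exact Finset.mem_image.2 ⟨l, Finset.mem_univ _, hl⟩
  have hq : ∀ l, F.q (σ l) = a (σ l) + 1 := fun l =>
    le_antisymm ((h (σ l)).2 ⟨l, rfl⟩) (haq (σ l))
  -- The exponents add up to `n - i`, and the `i` exterior factors supply the missing `i`.
  have hqs : ∑ l : Fin i, F.q (σ l) = n := by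
    simp only [hq, Finset.sum_add_distrib, ← hsum]
    simp only [Finset.sum_const, Finset.card_univ, Fintype.card_fin, smul_eq_mul, mul_one]
    change (a.degree : ℤ) = _ at had
    omega
  have hqt : ∀ l, F.q (σ l) ≤ t := by
    intro l
    rcases F.q_spec (σ l) with hl | hl
    · exact hl.1
    · have := Finset.single_le_sum (f := fun l => F.q (σ l)) (fun _ _ => Nat.zero_le _)
        (Finset.mem_univ l)
      simp only [hqs] at this
      omega
  have := Finset.sum_le_card_nsmul Finset.univ (fun l => F.q (σ l)) t fun l _ => hqt l
  simp only [hqs, Finset.card_univ, Fintype.card_fin, smul_eq_mul] at this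
  rw [mul_comm] at hn
  omega

/-- In degree zero every chain is a cycle and the homotopy has only the term `d h`. -/
lemma surjective_koszulD_zero [Fact p.Prime] (F : AdaptedFamily p V t n B) (hn : 0 < n) :
    ⊤ ≤ LinearMap.range (koszulD p V n 0) := by
  classical
  refine le_range_of_diagonal (koszulD p V n 0) ⊤ le_top (F.tensor 0) (F.span_tensor 0) ?_
  intro τ
  obtain ⟨b, hb⟩ := F.exists_moves (i := 0) (by simpa using hn) τ
  let E : koszulX p V n 0 →ₗ[ZMod p] koszulX p V n 0 :=
    koszulD p V n 0 ∘ₗ wedgeStep (F.div ((n : ℤ) - (0 + 1 : ℕ)) (by omega) b) (F.v b) 0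
  have hE : ∀ τ', E (F.tensor 0 τ') = if τ'.1.1 b = 0 then 0 else F.tensor 0 τ' := by
    intro τ'
    change koszulStep _ 0 (wedgeStep _ _ 0 (_ ⊗ₜ[ℤ] exteriorPower.ιMulti ℤ 0 _)) = _
    rw [koszulStep_wedgeStep_zero, F.mulV_div_cls]
    split_ifs
    · rw [TensorProduct.zero_tmul]
    · rfl
  refine ⟨E, fun z _ => ⟨_, rfl⟩, ?_, fun τ' => ?_⟩
  · rw [hE, if_neg]
    rcases hb with hb | ⟨⟨l, _⟩, _⟩
    · exact hb.2
    · exact l.elim0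
  · rw [hE]
    split_ifs
    · exact ⟨0, by simp⟩
    · exact ⟨1, by simp⟩

/-- On a cycle `d h + h d` reduces to `d h`, a boundary. On a tensor it is multiply-after-divide if
`v b` is not an exterior factor, and divide-after-multiply if it is; these two cases are the two
clauses of `Moves`. -/
lemma ker_koszulD_le_range [Fact p.Prime] (F : AdaptedFamily p V t n B) {i : ℕ}
    (hn : t * (i + 1) < n) :
    LinearMap.ker (koszulD p V n i) ≤ LinearMap.range (koszulD p V n (i + 1)) := by
  classical
  refine le_range_of_diagonal (koszulD p V n (i + 1)) _ ?_ (F.tensor (i + 1))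
    (F.span_tensor (i + 1)) ?_
  · rintro _ ⟨y, rfl⟩
    exact DFunLike.congr_fun (koszulD_comp p V n i) y
  intro τ
  obtain ⟨b, hb⟩ := F.exists_moves (i := i + 1) hn τ
  let E : koszulX p V n (i + 1) →ₗ[ZMod p] koszulX p V n (i + 1) :=
    koszulD p V n (i + 1) ∘ₗ
        wedgeStep (F.div ((n : ℤ) - (i + 1 + 1 : ℕ)) (by omega) b) (F.v b) (i + 1) +
      wedgeStep (F.div ((n : ℤ) - (i + 1 : ℕ)) (by omega) b) (F.v b) i ∘ₗ koszulD p V n i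
  have hE : ∀ τ', E (F.tensor (i + 1) τ') =
      if F.Moves b τ' then F.tensor (i + 1) τ' else 0 := by
    rintro ⟨a, ⟨σ, hσ⟩⟩
    change koszulStep _ (i + 1) (wedgeStep _ _ (i + 1) (_ ⊗ₜ[ℤ] exteriorPower.ιMulti ℤ (i + 1) _))
      + wedgeStep _ _ i (koszulStep _ i (_ ⊗ₜ[ℤ] exteriorPower.ιMulti ℤ (i + 1) _)) = _
    by_cases hbσ : b ∈ Set.range σ
    · obtain ⟨l₀, rfl⟩ := hbσ
      have h := koszulStep_wedgeStep_add_of_eq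
        (mulV (p := p) (V := V) (show ((n : ℤ) - (i + 1 : ℕ)) + 1 = n - i by push_cast; ring))
        (mulV (p := p) (V := V)
          (show ((n : ℤ) - (i + 1 + 1 : ℕ)) + 1 = n - (i + 1 : ℕ) by push_cast; ring))
        (F.div ((n : ℤ) - (i + 1 + 1 : ℕ)) (by omega) (σ l₀))
        (F.div ((n : ℤ) - (i + 1 : ℕ)) (by omega) (σ l₀)) i (F.cls _ a.1) (F.v ∘ σ) l₀
        fun l hl => F.div_mulV_cls_of_ne _ _ _ _ (hσ.ne hl) a
      refine h.trans ?_
      rw [Function.comp_apply, F.div_mulV_cls]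
      have hM : F.Moves (σ l₀) (a, (⟨σ, hσ⟩ : {σ : Fin (i + 1) → B // Function.Injective σ})) ↔
          a.1 (σ l₀) + 1 < F.q (σ l₀) := by
        simp [Moves]
      simp only [hM]
      split_ifs
      · rfl
      · rw [TensorProduct.zero_tmul]
    · have h := koszulStep_wedgeStep_add_of_comm
        (mulV (p := p) (V := V) (show ((n : ℤ) - (i + 1 : ℕ)) + 1 = n - i by push_cast; ring))
        (mulV (p := p) (V := V)
          (show ((n : ℤ) - (i + 1 + 1 : ℕ)) + 1 = n - (i + 1 : ℕ) by push_cast; ring))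
        (F.div ((n : ℤ) - (i + 1 + 1 : ℕ)) (by omega) b)
        (F.div ((n : ℤ) - (i + 1 : ℕ)) (by omega) b) (F.v b) i (F.cls _ a.1) (F.v ∘ σ)
        fun l => F.div_mulV_cls_of_ne _ _ _ _ (fun hl => hbσ ⟨l, hl⟩) a
      refine h.trans ?_
      rw [F.mulV_div_cls]
      have hM : F.Moves b (a, (⟨σ, hσ⟩ : {σ : Fin (i + 1) → B // Function.Injective σ})) ↔
          ¬ a.1 b = 0 := by
        simp only [Moves, hbσ, not_false_eq_true, true_and, false_and, or_false, ne_eq]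
      simp only [hM, ite_not]
      split_ifs
      · rw [TensorProduct.zero_tmul]
      · rfl
  refine ⟨E, fun z hz => ?_, ?_, fun τ' => ?_⟩
  · refine ⟨wedgeStep (F.div ((n : ℤ) - (i + 1 + 1 : ℕ)) (by omega) b) (F.v b) (i + 1) z, ?_⟩
    simp only [E, LinearMap.add_apply, LinearMap.comp_apply]
    rw [LinearMap.mem_ker.1 hz, map_zero, add_zero]
  · rw [hE, if_pos hb]
  · rw [hE]
    split_ifs
    · exact ⟨1, by simp⟩
    · exact ⟨0, by simp⟩

end AdaptedFamily

/-! ### Translation to the homology of the chain complex. -/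

lemma koszulComplex_d (p : ℕ) (V : Type u) [AddCommGroup V] (n i : ℕ) :
    (koszulComplex p V n).d (i + 1) i = ModuleCat.ofHom (koszulD p V n i) :=
  ChainComplex.of_d (fun i => ModuleCat.of (ZMod p) (koszulX p V n i))
    (fun i => ModuleCat.ofHom (koszulD p V n i)) i

/-- Vanishing of the homology of the Koszul complex, as exactness. -/
theorem koszulComplex_exactAt (p : ℕ) [Fact p.Prime] (V : Type u) [AddCommGroup V] (r : ℕ)
    (hV : ∀ (v : V) (k : ℕ), p ^ k • v = 0 → p ^ r • v = 0) (n i : ℕ) (hn : p ^ r * i < n) :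
    (koszulComplex p V n).ExactAt i := by
  classical
  obtain ⟨B, hB⟩ := exists_adaptedFamily (p := p) hV n
  obtain ⟨F⟩ := hB
  cases i with
  | zero =>
    rw [HomologicalComplex.exactAt_iff' _ 1 0 0 (by simp) (by simp),
      ShortComplex.moduleCat_exact_iff]
    intro x _
    obtain ⟨y, hy⟩ := F.surjective_koszulD_zero (by omega) (show x ∈ ⊤ from trivial)
    refine ⟨y, ?_⟩
    change ((koszulComplex p V n).d 1 0).hom y = x
    rw [koszulComplex_d p V n 0]
    exact hy
  | succ i =>
    rw [HomologicalComplex.exactAt_iff' _ (i + 2) (i + 1) i (by simp) (by simp),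
      ShortComplex.moduleCat_exact_iff]
    intro x hx
    change ((koszulComplex p V n).d (i + 1) i).hom x = 0 at hx
    rw [koszulComplex_d] at hx
    obtain ⟨y, hy⟩ := F.ker_koszulD_le_range hn hx
    refine ⟨y, ?_⟩
    change ((koszulComplex p V n).d (i + 1 + 1) (i + 1)).hom y = x
    rw [koszulComplex_d]
    exact hy

end KoszulGr

theorem mainTheorem8 (p : ℕ) [Fact p.Prime] (V : Type*) [AddCommGroup V] (r : ℕ)
    (hV : ∀ (v : V) (k : ℕ), p ^ k • v = 0 → p ^ r • v = 0)
    (n i : ℕ) (hn : p ^ r * i < n) :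
    CategoryTheory.Limits.IsZero ((KoszulGr.koszulComplex p V n).homology i) := by
  rw [← HomologicalComplex.exactAt_iff_isZero_homology]
  exact KoszulGr.koszulComplex_exactAt p V r hV n i hn
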